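/- **Lemma (Uniform a priori bounds).** For $\varepsilon\in(0,1)$ consider the isothermal relativistic Euler equations (sound speed $1$, light speed $1/\varepsilon$) $$\partial_t G+\partial_x H=0,\qquad \partial_t H+\partial_x F=0,$$ $$G=\frac{1+\varepsilon^4v^2}{1-\varepsilon^2v^2}\,\rho,\qquad H=\frac{1+\varepsilon^2}{1-\varepsilon^2v^2}\,\rho v,\qquad F=\frac{1+v^2}{1-\varepsilon^2v^2}\,\rho,$$ for the density $\rho\ge 0$ and the velocity $v$, where $|v|<1/\varepsilon$ if $\rho>0$, while in the vacuum $\rho=0$ the velocity is an arbitrary number with $|v|\le 1/\varepsilon$ and $G=H=F=0$. Put $\varepsilon'=2\varepsilon/(1+\varepsilon^2)$ and, for $M>0$, $$\mathcal T_\varepsilon(M)=\{(\rho,v): 0\le\rho\le M,\ 1-\varepsilon|v|\ge(\rho/M)^{\varepsilon'}\}.$$ *Riemann solutions.* A solution of the Riemann problem with left state $u_l$ and right state $u_r$ is a self-similar, piecewise $C^1$ function $(\rho,v)(x/t)$ with these data. In conservative variables $(G,H)$ it is $C^1$ and satisfies the equations away from finitely many values of $x/t$. At those values it has one-sided limits and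 takes the value of one of them, and the jump satisfies the Rankine–Hugoniot relations and the entropy inequality of every smooth weak entropy pair (one vanishing in the vacuum and continuous on each tame region) whose entropy is convex in $(G,H)$. *Lax–Friedrichs approximations.* Let $\tau,h>0$, $t_n=n\tau$ ($n\ge0$), $x_j=jh$ ($j\in\mathbb Z$). An approximation $(\rho^h,v^h)$ with initial data $(\rho_0,v_0)$ is given by cell states $(\rho_j^n,v_j^n)$, $n+j$ even, as follows. At time $t_n$ it equals $(\rho_j^n,v_j^n)$ on $[x_{j-1},x_{j+1})$. For $t_n<t<t_{n+1}$ and $x\in[x_j,x_{j+2})$, with $n+j$ even, it equals a solution of the Riemann problem with states $(\rho_j^n,v_j^n)$, $(\rho_{j+2}^n,v_{j+2}^n)$, centred at $(t_n,x_{j+1})$. The state $(\rho^{n+1}_{j+1},v^{n+1}_{j+1})$ is the one whose conservative variables $(G,H)$ are the averages over $(x_j,x_{j+2})$ of those of this Riemann solution at time $t_{n+1}-0$. In the same way $(\rho^0_j,v^0_j)$, $j$ even, is the state whose conservative variables are the averages over $(x_{j-1},x_{j+1})$ of those of $(\rho_0,v_0)$. *Claim.* Let $\varepsilon_0\in(0,1)$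 and let $\rho_0,v_0:\mathbb R\to\mathbb R$ be measurable with range included in $\mathcal T_{\varepsilon_0}(M_0)$ for some $M_0>0$. Then there is a constant $M>0$, depending only on $\varepsilon_0$ and $(\rho_0,v_0)$, such that for all $\varepsilon\in(0,\varepsilon_0]$ (in particular for $\varepsilon=\varepsilon_0$), all $\tau,h>0$ and every Lax–Friedrichs approximation $(\rho^h,v^h)$ with initial data $(\rho_0,v_0)$ that satisfies the CFL condition $$\frac{\tau}{h}\,\frac{|v^h(t,x)|+1}{1-\varepsilon^2|v^h(t,x)|}<\frac12\qquad\text{for all } t\ge0,\ x\in\mathbb R,$$ one has, for all $t\ge0$ and $x\in\mathbb R$, $$0\le\rho^h(t,x)\le M,\qquad 1-\varepsilon|v^h(t,x)|\ge\big(\rho^h(t,x)/M\big)^{\varepsilon'}.$$ -/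

import Mathlib

open Filter Topology
open scoped ContDiff

noncomputable section

namespace RelEuler

/-! A state is a pair `u = (ρ, v)`: mass density `u.1`, velocity `u.2`. The sound speed is
normalized to `1` and the light speed is `1 / ε`. -/

/-- Conserved energy density `G = (1 + ε⁴ v²) ρ / (1 - ε² v²)`. -/
def G (ε : ℝ) (u : ℝ × ℝ) : ℝ :=
  (1 + ε ^ 4 * u.2 ^ 2) / (1 - ε ^ 2 * u.2 ^ 2) * u.1

/-- Conserved momentum density `H = (1 + ε²) ρ v / (1 - ε² v²)`. -/
def H (ε : ℝ) (u : ℝ × ℝ) : ℝ :=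
  (1 + ε ^ 2) / (1 - ε ^ 2 * u.2 ^ 2) * u.1 * u.2

/-- Momentum flux `F = (1 + v²) ρ / (1 - ε² v²)`. -/
def F (ε : ℝ) (u : ℝ × ℝ) : ℝ :=
  (1 + u.2 ^ 2) / (1 - ε ^ 2 * u.2 ^ 2) * u.1

/-- The conservative variables. The Euler equations are
`∂ₜ G + ∂ₓ H = 0`, `∂ₜ H + ∂ₓ F = 0`. -/
def cons (ε : ℝ) (u : ℝ × ℝ) : ℝ × ℝ := (G ε u, H ε u)

/-- Physical states: nonnegative density, velocity below the light speed; in the vacuum (where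
the velocity has no meaning and `G = H = F = 0`) the value `|v| = 1 / ε` is permitted. -/
def phaseSpace (ε : ℝ) : Set (ℝ × ℝ) :=
  {u | 0 ≤ u.1 ∧ ε * |u.2| ≤ 1 ∧ (0 < u.1 → ε * |u.2| < 1)}

/-- Non-vacuum physical states. -/
def interiorStates (ε : ℝ) : Set (ℝ × ℝ) :=
  {u | 0 < u.1 ∧ ε * |u.2| < 1}

/-- The exponent `ε' = 2 ε / (1 + ε²)`. -/
def tameExponent (ε : ℝ) : ℝ := 2 * ε / (1 + ε ^ 2)

/-- The tame region `0 ≤ ρ ≤ M`, `1 - ε |v| ≥ (ρ / M) ^ ε'`. -/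
def tameRegion (ε M : ℝ) : Set (ℝ × ℝ) :=
  {u | 0 ≤ u.1 ∧ u.1 ≤ M ∧ (u.1 / M) ^ tameExponent ε ≤ 1 - ε * |u.2|}

/-- Tame initial data: measurable, with range included in some tame region (hence bounded). -/
def IsTameData (ε : ℝ) (u₀ : ℝ → ℝ × ℝ) : Prop :=
  Measurable u₀ ∧ ∃ M : ℝ, 0 < M ∧ ∀ x, u₀ x ∈ tameRegion ε M

/-- First characteristic speed. -/
def lam₁ (ε : ℝ) (u : ℝ × ℝ) : ℝ := (u.2 - 1) / (1 - ε ^ 2 * u.2)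

/-- Second characteristic speed. -/
def lam₂ (ε : ℝ) (u : ℝ × ℝ) : ℝ := (u.2 + 1) / (1 + ε ^ 2 * u.2)

/-- First characteristic direction in the `(ρ, v)` plane. -/
def r₁ (ε : ℝ) (u : ℝ × ℝ) : ℝ × ℝ :=
  (-1 / (1 - ε ^ 2 * u.2 ^ 2), 1 / ((1 + ε ^ 2) * u.1))

/-- Second characteristic direction in the `(ρ, v)` plane. -/
def r₂ (ε : ℝ) (u : ℝ × ℝ) : ℝ × ℝ :=
  (1 / (1 - ε ^ 2 * u.2 ^ 2), 1 / ((1 + ε ^ 2) * u.1))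

/-- `(U, Q)` is a smooth weak entropy pair (entropy, entropy flux), with `U` convex. -/
structure IsConvexWeakEntropyPair (ε : ℝ) (U Q : ℝ × ℝ → ℝ) : Prop where
  smooth_U : ContDiffOn ℝ ∞ U (interiorStates ε)
  smooth_Q : ContDiffOn ℝ ∞ Q (interiorStates ε)
  /-- The compatibility conditions `∇Q · rⱼ = λⱼ ∇U · rⱼ`. -/
  compat₁ : ∀ u ∈ interiorStates ε,
    fderiv ℝ Q u (r₁ ε u) = lam₁ ε u * fderiv ℝ U u (r₁ ε u)
  compat₂ : ∀ u ∈ interiorStates ε,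
    fderiv ℝ Q u (r₂ ε u) = lam₂ ε u * fderiv ℝ U u (r₂ ε u)
  continuousOn_U : ∀ M : ℝ, 0 < M → ContinuousOn U (tameRegion ε M)
  continuousOn_Q : ∀ M : ℝ, 0 < M → ContinuousOn Q (tameRegion ε M)
  /-- The pair vanishes on the vacuum. -/
  vacuum : ∀ v : ℝ, ε * |v| ≤ 1 → U (0, v) = 0 ∧ Q (0, v) = 0
  /-- `U` is a convex function of the conservative variables `(G, H)`, which range over the
  cone `ε |H| < G` when `(ρ, v)` ranges over the non-vacuum states. -/
  convex : ∃ Φ : ℝ × ℝ → ℝ, ConvexOn ℝ {p : ℝ × ℝ | ε * |p.2| < p.1} Φ ∧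
    ∀ u ∈ interiorStates ε, U u = Φ (cons ε u)

/-- The jump from the left state `a` to the right state `b`, travelling at speed `s`, satisfies
the Rankine-Hugoniot relations and all the entropy inequalities. Trivial jumps are included. -/
def IsEntropyJump (ε s : ℝ) (a b : ℝ × ℝ) : Prop :=
  H ε b - H ε a = s * (G ε b - G ε a) ∧
  F ε b - F ε a = s * (H ε b - H ε a) ∧
  ∀ U Q : ℝ × ℝ → ℝ, IsConvexWeakEntropyPair ε U Q → Q b - Q a ≤ s * (U b - U a)

/-- `(t, x) ↦ r (x / t)` is a self-similar, piecewise smooth entropy solution of the Euler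
equations, for the initial data equal to `ul` for `x < 0` and to `ur` for `x > 0`. Convergence is
expressed in the conservative variables, since the velocity has no meaning in the vacuum. -/
structure IsRiemannSolution (ε : ℝ) (ul ur : ℝ × ℝ) (r : ℝ → ℝ × ℝ) : Prop where
  mem_phaseSpace : ∀ ξ, r ξ ∈ phaseSpace ε
  left_data : Tendsto (fun ξ => cons ε (r ξ)) atBot (𝓝 (cons ε ul))
  right_data : Tendsto (fun ξ => cons ε (r ξ)) atTop (𝓝 (cons ε ur))
  /-- Outside of finitely many speeds `ξ` the solution is `C¹` and satisfies
  `- ξ G' + H' = 0`, `- ξ H' + F' = 0`, that is the Euler equations for functions of `ξ = x / t`.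
  At the exceptional speeds it has one-sided limits, which form an entropy admissible jump. -/
  piecewise : ∃ S : Finset ℝ,
    (∀ ξ, ξ ∉ S →
      ContDiffAt ℝ 1 (fun η => cons ε (r η)) ξ ∧
      HasDerivAt (fun η => H ε (r η)) (ξ * deriv (fun η => G ε (r η)) ξ) ξ ∧
      HasDerivAt (fun η => F ε (r η)) (ξ * deriv (fun η => H ε (r η)) ξ) ξ) ∧
    (∀ s ∈ S, ∃ a ∈ phaseSpace ε, ∃ b ∈ phaseSpace ε,
      Tendsto (fun ξ => cons ε (r ξ)) (𝓝[<] s) (𝓝 (cons ε a)) ∧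
      Tendsto (fun ξ => cons ε (r ξ)) (𝓝[>] s) (𝓝 (cons ε b)) ∧
      (r s = a ∨ r s = b) ∧
      IsEntropyJump ε s a b)

/-- The state `c` is the average over the interval `(x₀ - h, x₀ + h)` of the state field `u`:
the conservative variables of `c` are the means of those of `u`. -/
def IsCellAverage (ε h x₀ : ℝ) (u : ℝ → ℝ × ℝ) (c : ℝ × ℝ) : Prop :=
  c ∈ phaseSpace ε ∧
  G ε c = (2 * h)⁻¹ * ∫ x in (x₀ - h)..(x₀ + h), G ε (u x) ∧
  H ε c = (2 * h)⁻¹ * ∫ x in (x₀ - h)..(x₀ + h), H ε (u x)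

/-- `uh = (ρʰ, vʰ)`, a function of `t` and `x`, is the Lax-Friedrichs approximation with time
length `τ` and space length `h` issued from the initial data `u₀`. Here `tₙ = n τ`, `xⱼ = j h`, and
`cell n j`, used for `n + j` even only, is the state in the cell `[xⱼ₋₁, xⱼ₊₁)` at time `tₙ`. -/
def IsLaxFriedrichs (ε τ h : ℝ) (u₀ : ℝ → ℝ × ℝ) (uh : ℝ → ℝ → ℝ × ℝ) : Prop :=
  ∃ cell : ℕ → ℤ → ℝ × ℝ,
    -- the initial data are averaged over each cell
    (∀ j : ℤ, Even j → IsCellAverage ε h (j * h) u₀ (cell 0 j)) ∧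
    -- at time `tₙ` the approximation is constant in each cell
    (∀ (n : ℕ) (j : ℤ), Even ((n : ℤ) + j) →
      ∀ x ∈ Set.Ico ((j - 1 : ℝ) * h) ((j + 1 : ℝ) * h), uh (n * τ) x = cell n j) ∧
    -- for `tₙ < t < tₙ₊₁` it is given by the Riemann problem at the interface `xⱼ₊₁`, whose
    -- solution at time `tₙ₊₁ - 0` is then averaged over the interval from `xⱼ` to `xⱼ₊₂`
    (∀ (n : ℕ) (j : ℤ), Even ((n : ℤ) + j) →
      ∃ r : ℝ → ℝ × ℝ, IsRiemannSolution ε (cell n j) (cell n (j + 2)) r ∧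
        (∀ t ∈ Set.Ioo ((n : ℝ) * τ) ((n + 1 : ℝ) * τ),
          ∀ x ∈ Set.Ico ((j : ℝ) * h) ((j + 2 : ℝ) * h),
            uh t x = r ((x - (j + 1) * h) / (t - n * τ))) ∧
        IsCellAverage ε h ((j + 1) * h) (fun x => r ((x - (j + 1) * h) / τ))
          (cell (n + 1) (j + 1)))

/-- The CFL stability condition `(τ / h) (|vʰ| + 1) / (1 - ε² |vʰ|) < 1 / 2`, for all `(t, x)`. -/
def CFL (ε τ h : ℝ) (uh : ℝ → ℝ → ℝ × ℝ) : Prop :=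
  ∀ t x : ℝ, 0 ≤ t → τ / h * ((|(uh t x).2| + 1) / (1 - ε ^ 2 * |(uh t x).2|)) < 1 / 2

end RelEuler

end

/-! Let `b = (1 + ε v) / (1 - ε v)` be the boost factor of `v` and `k = (1 + ε²) / (2 ε) = 1 / ε'`.
The Riemann invariants are `ρ b ^ k` and `ρ b ^ (-k)`. The region where both are at most `M` is
contained in `𝒯_ε(M)`, and it contains `𝒯_ε(2 ^ (-k) M)`.

It is invariant under the Riemann problem. The negative of the particle number is a convex weak
entropy. Its inequality forces, at every jump with a non-vacuum left state, the second
characteristic speed on the left to exceed the speed of the jump, and `ρ b ^ k` not to increase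
from left to right. Hence from a point of a solution where the second characteristic speed is at
most `x / t` there is no jump further to the right, and neither `ρ` nor `ρ b ^ k` decreases on the
way to the right state. Where the second characteristic speed exceeds `x / t`, it does so all the
way to the left state, and `ρ b ^ k` does not decrease in that direction. Reflection gives the
bound for `ρ b ^ (-k)`.

It is stable under averaging of `(G, H)`, in which it is an intersection of half-planes.

The choice of `M` is uniform in `ε ≤ ε₀` since the coefficients of the power series
`k log b = (1 + ε²) ∑ ε ^ (2 n) v ^ (2 n + 1) / (2 n + 1)` increase with `ε`. -/

noncomputable section

namespace RelEuler

/-! ### Real analysis -/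

lemma sinh_mul_le_mul_sinh {c a : ℝ} (hc0 : 0 ≤ c) (hc1 : c ≤ 1) (ha : 0 ≤ a) :
    Real.sinh (c * a) ≤ c * Real.sinh a := by
  have hderiv : ∀ x, HasDerivAt (fun x => c * Real.sinh x - Real.sinh (c * x))
      (c * Real.cosh x - Real.cosh (c * x) * (c * 1)) x := fun x =>
    ((Real.hasDerivAt_sinh x).const_mul c).sub (((hasDerivAt_id x).const_mul c).sinh)
  have hmono : Monotone fun x => c * Real.sinh x - Real.sinh (c * x) :=
    monotone_of_deriv_nonneg (fun x => (hderiv x).differentiableAt) fun x => by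
      have hcosh : Real.cosh (c * x) ≤ Real.cosh x := by
        rw [Real.cosh_le_cosh, abs_mul, abs_of_nonneg hc0]
        exact mul_le_of_le_one_left (abs_nonneg x) hc1
      rw [(hderiv x).deriv]
      nlinarith
  simpa using hmono ha

lemma mul_sinh_mul_cosh_lt {d a : ℝ} (hd0 : 0 < d) (hd1 : d < 1) (ha : 0 < a) :
    d * Real.sinh a * Real.cosh (d * a) < Real.sinh (d * a) * Real.cosh a := by
  have hderiv : ∀ x, HasDerivAt
      (fun x => Real.sinh (d * x) * Real.cosh x - d * Real.sinh x * Real.cosh (d * x))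
      ((1 - d ^ 2) * (Real.sinh x * Real.sinh (d * x))) x := fun x =>
    (((((hasDerivAt_id' x).const_mul d).sinh).mul (Real.hasDerivAt_cosh x)).sub
      (((Real.hasDerivAt_sinh x).const_mul d).mul
        (((hasDerivAt_id' x).const_mul d).cosh))).congr_deriv (by ring)
  have hmono := strictMonoOn_of_deriv_pos (convex_Ici (0 : ℝ))
    (fun x _ => (hderiv x).continuousAt.continuousWithinAt) fun x hx => by
      rw [interior_Ici] at hx
      rw [(hderiv x).deriv]
      have hsinh : 0 < Real.sinh x := Real.sinh_pos_iff.2 hx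
      have hsinh_mul : 0 < Real.sinh (d * x) := Real.sinh_pos_iff.2 (mul_pos hd0 hx)
      have : 0 < 1 - d ^ 2 := by nlinarith
      positivity
  simpa using hmono Set.self_mem_Ici ha.le ha

lemma exists_exp_two_mul_eq {R : ℝ} (hR : 0 < R) : ∃ a, Real.exp (2 * a) = R :=
  ⟨Real.log R / 2, by rw [mul_div_cancel₀ _ two_ne_zero, Real.exp_log hR]⟩

-- The quotient `((1 + d) R + (1 - d)) / ((1 - d) R + (1 + d))` is the Padé approximant of `R ^ d`
-- at `R = 1`; for `R = exp (2 a)` the bound reads `d * tanh a < tanh (d * a)`.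
lemma pade_lt_rpow {d R : ℝ} (hd0 : 0 < d) (hd1 : d < 1) (hR : 1 < R) :
    (1 + d) * R + (1 - d) < R ^ d * ((1 - d) * R + (1 + d)) := by
  obtain ⟨a, rfl⟩ := exists_exp_two_mul_eq (zero_lt_one.trans hR)
  have ha : 0 < a := by linarith [Real.one_lt_exp_iff.1 hR]
  have htanh := mul_sinh_mul_cosh_lt hd0 hd1 ha
  have hpos := mul_pos (Real.exp_pos a) (Real.exp_pos (d * a))
  have hexp : Real.exp (2 * a) = Real.exp a ^ 2 := by rw [← Real.exp_nat_mul]; norm_num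
  have hrpow : Real.exp (2 * a) ^ d = Real.exp (d * a) ^ 2 := by
    rw [← Real.exp_mul, ← Real.exp_nat_mul]; ring_nf
  rw [← Real.cosh_add_sinh a, ← Real.cosh_add_sinh (d * a)] at hpos
  rw [hrpow, hexp, ← Real.cosh_add_sinh a, ← Real.cosh_add_sinh (d * a)]
  have hcosh_a := Real.cosh_sq_sub_sinh_sq a
  have hcosh_da := Real.cosh_sq_sub_sinh_sq (d * a)
  generalize Real.cosh a = C, Real.sinh a = S, Real.cosh (d * a) = c, Real.sinh (d * a) = s at *
  have hgap : (c + s) ^ 2 * ((1 - d) * (C + S) ^ 2 + (1 + d)) - ((1 + d) * (C + S) ^ 2 + (1 - d)) =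
      4 * ((C + S) * (c + s) * (s * C - d * S * c)) := by
    linear_combination (1 - d - (1 + d) * (c + s) ^ 2) * hcosh_a +
      2 * (C + S) * (C + d * S) * hcosh_da
  linarith [mul_pos hpos (sub_pos.2 htanh)]

lemma rpow_lt_pade {d R : ℝ} (hd0 : 0 < d) (hd1 : d < 1) (hR0 : 0 < R) (hR1 : R < 1) :
    R ^ d * ((1 - d) * R + (1 + d)) < (1 + d) * R + (1 - d) := by
  have hinv := pade_lt_rpow hd0 hd1 ((one_lt_inv₀ hR0).2 hR1)
  rw [Real.inv_rpow hR0.le] at hinv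
  calc R ^ d * ((1 - d) * R + (1 + d)) = R ^ d * R * ((1 + d) * R⁻¹ + (1 - d)) := by
        field_simp; ring
    _ < R ^ d * R * ((R ^ d)⁻¹ * ((1 - d) * R⁻¹ + (1 + d))) := by gcongr
    _ = (1 + d) * R + (1 - d) := by field_simp; ring

-- With `R = exp (2 a)` and `y = exp (-2 b)` the hypothesis says `sinh b = c * sinh a`, and the
-- conclusion `c * a ≤ b`.
lemma rpow_mul_le_one_of_sq_eq {c R y : ℝ} (hc0 : 0 ≤ c) (hc1 : c ≤ 1) (hR : 1 ≤ R)
    (hy0 : 0 < y) (hy1 : y ≤ 1) (h : (1 - y) ^ 2 * R = c ^ 2 * (R - 1) ^ 2 * y) :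
    R ^ c * y ≤ 1 := by
  obtain ⟨a, rfl⟩ := exists_exp_two_mul_eq (zero_lt_one.trans_le hR)
  obtain ⟨b, hb⟩ := exists_exp_two_mul_eq (inv_pos.2 hy0)
  obtain rfl : y = Real.exp (-(2 * b)) := by rw [Real.exp_neg, hb, inv_inv]
  have ha : 0 ≤ a := by linarith [Real.one_le_exp_iff.1 hR]
  have hb0 : 0 ≤ b := by linarith [Real.exp_le_one_iff.1 hy1]
  have hsub_a : Real.exp (2 * a) - 1 = 2 * Real.exp a * Real.sinh a := by
    rw [two_mul, Real.exp_add, Real.sinh_eq, Real.exp_neg]; field_simp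
  have hsub_b : 1 - Real.exp (-(2 * b)) = 2 * Real.exp (-b) * Real.sinh b := by
    rw [two_mul, neg_add, Real.exp_add, Real.sinh_eq, Real.exp_neg]; field_simp
  have hsq : Real.sinh b ^ 2 = (c * Real.sinh a) ^ 2 := by
    rw [hsub_a, hsub_b, two_mul a, two_mul b, neg_add, Real.exp_add, Real.exp_add] at h
    apply mul_left_cancel₀ (a := (2 * Real.exp (-b) * Real.exp a) ^ 2) (by positivity)
    linear_combination h
  have hsinh : Real.sinh b = c * Real.sinh a :=
    (pow_left_inj₀ (Real.sinh_nonneg_iff.2 hb0)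
      (mul_nonneg hc0 (Real.sinh_nonneg_iff.2 ha)) two_ne_zero).1 hsq
  have hle : c * a ≤ b := Real.sinh_le_sinh.1 (hsinh ▸ sinh_mul_le_mul_sinh hc0 hc1 ha)
  rw [← Real.exp_mul, ← Real.exp_add, Real.exp_le_one_iff]
  linarith

section RealInduction

variable {α : Type*} [ConditionallyCompleteLinearOrder α] [TopologicalSpace α] [OrderTopology α]
  {P : α → Prop} {a : α}

lemma forall_ge_of_eventually_nhdsGT [NoMaxOrder α] (ha : P a)
    (hstep : ∀ t, a ≤ t → P t → ∀ᶠ x in 𝓝[>] t, P x)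
    (hlimit : ∀ t, a < t → (∀ x, a ≤ x → x < t → P x) → P t) : ∀ x, a ≤ x → P x := by
  by_contra! hfail
  set B : Set α := {x | a ≤ x ∧ ¬ P x}
  have hne : B.Nonempty := hfail
  have hbdd : BddBelow B := ⟨a, fun x hx => hx.1⟩
  have ha_le : a ≤ sInf B := le_csInf hne fun x hx => hx.1
  have hbelow : ∀ x, a ≤ x → x < sInf B → P x := fun x hax hx =>
    by_contra fun hPx => (csInf_le hbdd ⟨hax, hPx⟩).not_gt hx
  have hinf : P (sInf B) := by
    rcases ha_le.eq_or_lt with h | h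
    · rwa [← h]
    · exact hlimit _ h hbelow
  obtain ⟨b, hb, hsub⟩ := mem_nhdsGT_iff_exists_Ioo_subset.1 (hstep _ ha_le hinf)
  refine (le_csInf hne fun x hx => ?_ : b ≤ sInf B).not_gt hb
  by_contra! hxb
  rcases (csInf_le hbdd hx).eq_or_lt with h | h
  · exact hx.2 (h ▸ hinf)
  · exact hx.2 (hsub ⟨h, hxb⟩)

lemma forall_le_of_eventually_nhdsLT [NoMinOrder α] (ha : P a)
    (hstep : ∀ t, t ≤ a → P t → ∀ᶠ x in 𝓝[<] t, P x)
    (hlimit : ∀ t, t < a → (∀ x, t < x → x ≤ a → P x) → P t) : ∀ x, x ≤ a → P x :=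
  forall_ge_of_eventually_nhdsGT (α := αᵒᵈ) ha hstep fun t ht h =>
    hlimit t ht fun x htx hxa => h x hxa htx

end RealInduction

section MonotoneLimit

variable {α β : Type*} [LinearOrder α] [TopologicalSpace α] [OrderTopology α] [DenselyOrdered α]
  [Preorder β] [TopologicalSpace β] [OrderClosedTopology β] {f : α → β} {p q : α} {L : β}

lemma le_of_monotoneOn_Ioo_of_tendsto (hf : MonotoneOn f (Set.Ioo p q))
    (hL : Tendsto f (𝓝[>] p) (𝓝 L)) : ∀ x ∈ Set.Ioo p q, L ≤ f x := fun x hx => by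
  have := nhdsGT_neBot_of_exists_gt ⟨x, hx.1⟩
  refine le_of_tendsto hL ?_
  filter_upwards [Ioo_mem_nhdsGT hx.1] with y hy
  exact hf ⟨hy.1, hy.2.trans hx.2⟩ hx hy.2.le

lemma le_of_antitoneOn_Ioo_of_tendsto (hf : AntitoneOn f (Set.Ioo p q))
    (hL : Tendsto f (𝓝[>] p) (𝓝 L)) : ∀ x ∈ Set.Ioo p q, f x ≤ L :=
  le_of_monotoneOn_Ioo_of_tendsto (β := βᵒᵈ) hf hL

end MonotoneLimit

lemma le_of_forall_hasDerivAt_mul_sub_nonpos {f f' : ℝ → ℝ} {s : Set ℝ} (hs : s.OrdConnected)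
    (hf : ∀ x ∈ s, HasDerivAt f (f' x) x) {y z : ℝ} (hy : y ∈ s) (hz : z ∈ s)
    (hsign : ∀ x ∈ s, f' x * (x - z) ≤ 0) : f y ≤ f z := by
  have slope_eq {a b : ℝ} (ha : a ∈ s) (hb : b ∈ s) (hab : a < b) :
      ∃ x ∈ s, x ∈ Set.Ioo a b ∧ f b - f a = f' x * (b - a) := by
    obtain ⟨x, hx, hslope⟩ := exists_hasDerivAt_eq_slope f f' hab
      (fun x hx => (hf x (hs.out ha hb hx)).continuousAt.continuousWithinAt)
      fun x hx => hf x (hs.out ha hb (Set.Ioo_subset_Icc_self hx))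
    exact ⟨x, hs.out ha hb (Set.Ioo_subset_Icc_self hx), hx,
      by rw [hslope, div_mul_cancel₀ _ (sub_pos.2 hab).ne']⟩
  rcases lt_trichotomy y z with hyz | rfl | hzy
  · obtain ⟨x, hxs, hx, hslope⟩ := slope_eq hy hz hyz
    have hnonneg := nonneg_of_mul_nonpos_left (hsign x hxs) (sub_neg.2 hx.2)
    nlinarith
  · exact le_rfl
  · obtain ⟨x, hxs, hx, hslope⟩ := slope_eq hz hy hzy
    have hnonpos := nonpos_of_mul_nonpos_left (hsign x hxs) (sub_pos.2 hx.1)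
    nlinarith

lemma measurable_of_continuousAt_of_notMem_countable {X Y : Type*} [TopologicalSpace X]
    [MeasurableSpace X] [OpensMeasurableSpace X] [MeasurableSingletonClass X] [TopologicalSpace Y]
    [MeasurableSpace Y] [BorelSpace Y] [Nonempty Y] {f : X → Y} {S : Set X} (hS : S.Countable)
    (hf : ∀ x, x ∉ S → ContinuousAt f x) : Measurable f := by
  classical
  obtain ⟨y⟩ := ‹Nonempty Y›
  have hpiecewise : Measurable (Sᶜ.piecewise f fun _ => y) :=
    ContinuousOn.measurable_piecewise (fun x hx => (hf x hx).continuousWithinAt)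
      continuousOn_const hS.measurableSet.compl
  refine hpiecewise.measurable_of_countable_ne (hS.mono fun x hx => ?_)
  by_contra hxS
  exact hx (Set.piecewise_eq_of_mem _ _ _ hxS)

/-! ### Null variables -/

/-- The Doppler factor `(1 + ε v) / (1 - ε v)` of a velocity; its logarithm is twice the
rapidity, so that Lorentz transformations act on it by multiplication. -/
def boost (ε v : ℝ) : ℝ := (1 + ε * v) / (1 - ε * v)

/-- The null variables of a state: the density together with the two null components
`ρ b` and `ρ / b` of the energy-momentum tensor (up to constants), where `b` is the boost factor
of the velocity. -/
def nullState (ε : ℝ) (u : ℝ × ℝ) : ℝ × ℝ × ℝ :=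
  (u.1, u.1 * boost ε u.2, u.1 / boost ε u.2)

/-- The density as a function of the conservative variables: the nonnegative root of
`ε² ρ² + (1 - ε²) G ρ = G² - ε² H²`. -/
def densityOf (ε : ℝ) (p : ℝ × ℝ) : ℝ :=
  (-((1 - ε ^ 2) * p.1) + √(((1 - ε ^ 2) * p.1) ^ 2 + 4 * ε ^ 2 * (p.1 ^ 2 - ε ^ 2 * p.2 ^ 2))) /
    (2 * ε ^ 2)

/-- The null variables as functions of the conservative variables. -/
def nullOf (ε : ℝ) (p : ℝ × ℝ) : ℝ × ℝ × ℝ :=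
  (densityOf ε p,
    (p.1 + 2 * ε * p.2 + (p.1 - (1 - ε ^ 2) * densityOf ε p)) / (1 + ε ^ 2),
    (p.1 - 2 * ε * p.2 + (p.1 - (1 - ε ^ 2) * densityOf ε p)) / (1 + ε ^ 2))

section NullVariables

variable {ε v : ℝ} {u p : ℝ × ℝ}

lemma one_sub_mul_pos (hε : 0 < ε) (hv : ε * |v| < 1) : 0 < 1 - ε * v := by
  linarith [mul_le_mul_of_nonneg_left (le_abs_self v) hε.le]

lemma one_add_mul_pos (hε : 0 < ε) (hv : ε * |v| < 1) : 0 < 1 + ε * v := by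
  linarith [mul_le_mul_of_nonneg_left (neg_abs_le v) hε.le]

lemma one_sub_sq_mul_sq (ε v : ℝ) : 1 - ε ^ 2 * v ^ 2 = (1 - ε * v) * (1 + ε * v) := by ring

lemma one_sub_sq_mul_sq_pos (hε : 0 < ε) (hv : ε * |v| < 1) : 0 < 1 - ε ^ 2 * v ^ 2 := by
  rw [one_sub_sq_mul_sq]
  exact mul_pos (one_sub_mul_pos hε hv) (one_add_mul_pos hε hv)

lemma boost_pos (hε : 0 < ε) (hv : ε * |v| < 1) : 0 < boost ε v :=
  div_pos (one_add_mul_pos hε hv) (one_sub_mul_pos hε hv)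

lemma boost_neg (ε v : ℝ) : boost ε (-v) = (boost ε v)⁻¹ := by
  simp [boost, sub_eq_add_neg]

lemma mem_interiorStates_or_eq_zero (hu : u ∈ phaseSpace ε) : u ∈ interiorStates ε ∨ u.1 = 0 := by
  rcases hu.1.eq_or_lt with h | h
  · exact .inr h.symm
  · exact .inl ⟨h, hu.2.2 h⟩

lemma interiorStates_subset_phaseSpace : interiorStates ε ⊆ phaseSpace ε :=
  fun _ hu => ⟨hu.1.le, hu.2.le, fun _ => hu.2⟩

lemma density_eq (hε : 0 < ε) (hu : u ∈ phaseSpace ε) :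
    (1 - ε ^ 2) * u.1 = G ε u - ε ^ 2 * F ε u := by
  rcases mem_interiorStates_or_eq_zero hu with h | h
  · have := one_sub_sq_mul_sq_pos hε h.2
    simp only [G, F]; field_simp; ring
  · simp [G, F, h]

lemma density_mul_boost_eq (hε : 0 < ε) (hu : u ∈ phaseSpace ε) :
    (1 + ε ^ 2) * (u.1 * boost ε u.2) = G ε u + 2 * ε * H ε u + ε ^ 2 * F ε u := by
  rcases mem_interiorStates_or_eq_zero hu with h | h
  · have := one_sub_mul_pos hε h.2
    have := one_add_mul_pos hε h.2
    simp only [G, H, F, boost, one_sub_sq_mul_sq]; field_simp; ring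
  · simp [G, H, F, h]

lemma density_div_boost_eq (hε : 0 < ε) (hu : u ∈ phaseSpace ε) :
    (1 + ε ^ 2) * (u.1 / boost ε u.2) = G ε u - 2 * ε * H ε u + ε ^ 2 * F ε u := by
  rcases mem_interiorStates_or_eq_zero hu with h | h
  · have := one_sub_mul_pos hε h.2
    have := one_add_mul_pos hε h.2
    simp only [G, H, F, boost, one_sub_sq_mul_sq]; field_simp; ring
  · simp [G, H, F, h]

lemma G_eq (hε : 0 < ε) (hu : u ∈ phaseSpace ε) :
    G ε u = ((1 + ε ^ 2) * (u.1 * boost ε u.2 + u.1 / boost ε u.2)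
      + 2 * (1 - ε ^ 2) * u.1) / 4 := by
  linarith [density_eq hε hu, density_mul_boost_eq hε hu, density_div_boost_eq hε hu]

lemma mul_H_eq (hε : 0 < ε) (hu : u ∈ phaseSpace ε) :
    ε * H ε u = (1 + ε ^ 2) * (u.1 * boost ε u.2 - u.1 / boost ε u.2) / 4 := by
  linarith [density_mul_boost_eq hε hu, density_div_boost_eq hε hu]

lemma H_eq_mul (hε : 0 < ε) (hu : u ∈ interiorStates ε) :
    H ε u = u.2 * (G ε u + ε ^ 2 * u.1) := by
  have := one_sub_sq_mul_sq_pos hε hu.2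
  simp only [G, H]; field_simp; ring

lemma G_nonneg (hε : 0 < ε) (hu : u ∈ phaseSpace ε) : 0 ≤ G ε u := by
  rcases mem_interiorStates_or_eq_zero hu with h | h
  · have := one_sub_sq_mul_sq_pos hε h.2
    have := h.1
    simp only [G]; positivity
  · simp [G, h]

lemma mul_abs_H_le_G (hε : 0 < ε) (hε1 : ε < 1) (hu : u ∈ phaseSpace ε) :
    ε * |H ε u| ≤ G ε u := by
  obtain ⟨hplus, hminus⟩ : 0 ≤ u.1 * boost ε u.2 ∧ 0 ≤ u.1 / boost ε u.2 := by
    rcases mem_interiorStates_or_eq_zero hu with h | h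
    · exact ⟨(mul_pos h.1 (boost_pos hε h.2)).le, (div_pos h.1 (boost_pos hε h.2)).le⟩
    · simp [h]
  have hdensity : 0 ≤ (1 - ε ^ 2) * u.1 := mul_nonneg (by nlinarith) hu.1
  have hplus' := mul_nonneg (by positivity : (0 : ℝ) ≤ 1 + ε ^ 2) hplus
  have hminus' := mul_nonneg (by positivity : (0 : ℝ) ≤ 1 + ε ^ 2) hminus
  rw [← abs_of_pos hε, ← abs_mul, abs_of_pos hε, mul_H_eq hε hu, G_eq hε hu, abs_le]
  constructor <;> linarith

lemma density_quadratic (hε : 0 < ε) (hu : u ∈ phaseSpace ε) :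
    ε ^ 2 * u.1 ^ 2 + (1 - ε ^ 2) * G ε u * u.1 = G ε u ^ 2 - ε ^ 2 * H ε u ^ 2 := by
  rcases mem_interiorStates_or_eq_zero hu with h | h
  · have := one_sub_sq_mul_sq_pos hε h.2
    simp only [G, H]; field_simp; ring
  · simp [G, H, h]

lemma densityOf_cons (hε : 0 < ε) (hε1 : ε < 1) (hu : u ∈ phaseSpace ε) :
    densityOf ε (cons ε u) = u.1 := by
  have hG := G_nonneg hε hu
  have hρ := hu.1
  have hε2 : 0 ≤ 1 - ε ^ 2 := by nlinarith
  have hdisc : ((1 - ε ^ 2) * G ε u) ^ 2 + 4 * ε ^ 2 * (G ε u ^ 2 - ε ^ 2 * H ε u ^ 2) =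
      (2 * ε ^ 2 * u.1 + (1 - ε ^ 2) * G ε u) ^ 2 := by
    rw [← density_quadratic hε hu]; ring
  rw [densityOf, cons, hdisc, Real.sqrt_sq (by positivity)]
  field_simp; ring

lemma nullOf_cons (hε : 0 < ε) (hε1 : ε < 1) (hu : u ∈ phaseSpace ε) :
    nullOf ε (cons ε u) = nullState ε u := by
  have hne : 1 + ε ^ 2 ≠ 0 := by positivity
  simp only [nullOf, nullState, densityOf_cons hε hε1 hu, density_eq hε hu]
  refine Prod.ext rfl (Prod.ext ((div_eq_iff hne).2 ?_) ((div_eq_iff hne).2 ?_))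
  · simp only [cons]; linear_combination -density_mul_boost_eq hε hu
  · simp only [cons]; linear_combination -density_div_boost_eq hε hu

lemma continuous_nullOf (ε : ℝ) : Continuous (nullOf ε) := by
  unfold nullOf densityOf
  fun_prop

lemma sq_sub_sq_pos_of_mul_abs_lt (hε : 0 < ε) (hp : ε * |p.2| < p.1) :
    0 < p.1 ^ 2 - ε ^ 2 * p.2 ^ 2 := by
  have hsq : (ε * |p.2|) ^ 2 < p.1 ^ 2 := pow_lt_pow_left₀ hp (by positivity) two_ne_zero
  rwa [mul_pow, sq_abs, ← sub_pos] at hsq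

lemma densityOf_pos (hε : 0 < ε) (hp : ε * |p.2| < p.1) : 0 < densityOf ε p := by
  have hsq := sq_sub_sq_pos_of_mul_abs_lt hε hp
  refine div_pos ?_ (by positivity)
  rw [neg_add_eq_sub, sub_pos]
  exact Real.lt_sqrt_of_sq_lt (lt_add_of_pos_right _ (by positivity))

lemma densityOf_quadratic (hε : 0 < ε) (hp : ε * |p.2| < p.1) :
    ε ^ 2 * densityOf ε p ^ 2 + (1 - ε ^ 2) * p.1 * densityOf ε p = p.1 ^ 2 - ε ^ 2 * p.2 ^ 2 := by
  have hsq := sq_sub_sq_pos_of_mul_abs_lt hε hp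
  have hsqrt := Real.sq_sqrt (show
    0 ≤ ((1 - ε ^ 2) * p.1) ^ 2 + 4 * ε ^ 2 * (p.1 ^ 2 - ε ^ 2 * p.2 ^ 2) by positivity)
  have hroot : √(((1 - ε ^ 2) * p.1) ^ 2 + 4 * ε ^ 2 * (p.1 ^ 2 - ε ^ 2 * p.2 ^ 2)) =
      2 * ε ^ 2 * densityOf ε p + (1 - ε ^ 2) * p.1 := by
    rw [densityOf, mul_div_cancel₀ _ (by positivity)]; ring
  rw [hroot] at hsqrt
  apply mul_left_cancel₀ (show 4 * ε ^ 2 ≠ 0 by positivity)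
  linear_combination hsqrt

lemma exists_cons_eq (hε : 0 < ε) (hp : ε * |p.2| < p.1) :
    ∃ u ∈ interiorStates ε, cons ε u = p := by
  have hg : 0 < p.1 := (by positivity : 0 ≤ ε * |p.2|).trans_lt hp
  have hρ := densityOf_pos hε hp
  have hquad := densityOf_quadratic hε hp
  generalize densityOf ε p = ρ at hρ hquad
  have hK : 0 < p.1 + ε ^ 2 * ρ := by positivity
  have hden : 1 - ε ^ 2 * (p.2 / (p.1 + ε ^ 2 * ρ)) ^ 2 =
      (1 + ε ^ 2) * ρ / (p.1 + ε ^ 2 * ρ) := by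
    field_simp
    linear_combination -hquad
  refine ⟨(ρ, p.2 / (p.1 + ε ^ 2 * ρ)), ⟨hρ, ?_⟩, Prod.ext ?_ ?_⟩
  · rw [abs_div, abs_of_pos hK, ← mul_div_assoc, div_lt_one hK]
    exact hp.trans (lt_add_of_pos_right _ (by positivity))
  · simp only [cons, G, hden]
    field_simp
    linear_combination ε ^ 2 * hquad
  · simp only [cons, H, hden]
    field_simp

end NullVariables

/-! ### Admissible jumps in the null variables -/

/-- `(1 - ε) / (1 + ε)`, the boost factor of the velocity `-1`: across a state with boost factor
`b`, sound waves travel with boost factors `sonicBoost ε * b` and `b / sonicBoost ε`. -/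
def sonicBoost (ε : ℝ) : ℝ := (1 - ε) / (1 + ε)

/-- `(1 - ε²) / (1 + ε²)`, the coefficient of the density when the Euler equations are written in
the null variables. -/
def nullCoeff (ε : ℝ) : ℝ := (1 - ε ^ 2) / (1 + ε ^ 2)

section NullJumps

variable {ε : ℝ}

lemma sonicBoost_pos (hε : 0 < ε) (hε1 : ε < 1) : 0 < sonicBoost ε :=
  div_pos (by linarith) (by linarith)

lemma sonicBoost_lt_one (hε : 0 < ε) : sonicBoost ε < 1 := by
  rw [sonicBoost, div_lt_one (by linarith)]; linarith

lemma nullCoeff_pos (hε : 0 < ε) (hε1 : ε < 1) : 0 < nullCoeff ε :=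
  div_pos (by nlinarith) (by positivity)

lemma nullCoeff_lt_one (hε : 0 < ε) : nullCoeff ε < 1 := by
  rw [nullCoeff, div_lt_one (by positivity)]; nlinarith

lemma nullCoeff_mul (hε : 0 < ε) : nullCoeff ε * (1 + sonicBoost ε ^ 2) = 2 * sonicBoost ε := by
  simp only [nullCoeff, sonicBoost]; field_simp; ring

lemma tameExponent_pos (hε : 0 < ε) : 0 < tameExponent ε := by
  unfold tameExponent; positivity

lemma tameExponent_le_one (ε : ℝ) : tameExponent ε ≤ 1 := by
  rw [tameExponent, div_le_one (by positivity)]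
  linarith [two_mul_le_add_sq ε 1]

lemma tameExponent_sq (hε : 0 < ε) : tameExponent ε ^ 2 = 1 - nullCoeff ε ^ 2 := by
  simp only [nullCoeff, tameExponent]; field_simp; ring

/-- The Rankine-Hugoniot relations of a nontrivial jump between two non-vacuum states, in the frame
of the left state: `R` and `y` are the quotients of the densities and of the boost factors, `μ` is
the boost factor of the shock speed, and `d` stands for `nullCoeff ε`. -/
structure IsHugoniotRatio (d R y μ : ℝ) : Prop where
  density_pos : 0 < R
  density_ne_one : R ≠ 1
  boost_pos : 0 < y
  speed_pos : 0 < μ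
  plus : R * y - 1 = μ * d * (R - 1)
  minus : d * (R - 1) = μ * (R / y - 1)

namespace IsHugoniotRatio

variable {d R y μ : ℝ}

lemma div_mul_speed (h : IsHugoniotRatio d R y μ) : R / y * μ = μ + d * (R - 1) := by
  linear_combination -h.minus

lemma density_mul (h : IsHugoniotRatio d R y μ) :
    R * μ * (1 - d ^ 2) = (d * μ - 1) * (μ - d) := by
  have := h.boost_pos
  have hprod : R * y * (R / y * μ) = R ^ 2 * μ := by field_simp
  rw [h.div_mul_speed] at hprod
  apply mul_left_cancel₀ (sub_ne_zero.2 h.density_ne_one)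
  linear_combination -hprod + (μ + d * (R - 1)) * h.plus

lemma density_sub_one_mul (h : IsHugoniotRatio d R y μ) :
    (R - 1) * (μ * (1 - d ^ 2)) = d * μ ^ 2 - 2 * μ + d := by
  linear_combination h.density_mul

lemma mul_boost (h : IsHugoniotRatio d R y μ) : R * y * (1 - d ^ 2) = (d * μ - 1) ^ 2 := by
  linear_combination (1 - d ^ 2) * h.plus + d * h.density_sub_one_mul

lemma div_boost (h : IsHugoniotRatio d R y μ) :
    R / y * (μ ^ 2 * (1 - d ^ 2)) = (μ - d) ^ 2 := by
  linear_combination μ * (1 - d ^ 2) * h.div_mul_speed + d * h.density_sub_one_mul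

lemma boost_sub_one_mul (h : IsHugoniotRatio d R y μ) (hd : d ^ 2 < 1) :
    (y - 1) * (μ - d) = (R - 1) * (μ * (1 - d ^ 2)) := by
  have hne : R * (1 - d ^ 2) ≠ 0 := mul_ne_zero h.density_pos.ne' (sub_pos.2 hd).ne'
  apply mul_left_cancel₀ hne
  linear_combination (μ - d) * h.mul_boost - (d * μ - 1) * h.density_mul -
    R * (1 - d ^ 2) * h.density_sub_one_mul

lemma sq_boost_sub_one (h : IsHugoniotRatio d R y μ) :
    (1 - y) ^ 2 * R = (1 - d ^ 2) * (R - 1) ^ 2 * y := by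
  have hy := h.boost_pos
  have hminus : d * (R - 1) * y = μ * (R - y) := by rw [h.minus]; field_simp
  apply mul_left_cancel₀ h.speed_pos.ne'
  linear_combination (R * y - 1) * hminus - d * (R - 1) * y * h.plus

lemma mul_pos_of_sq_lt_one (h : IsHugoniotRatio d R y μ) (hd : d ^ 2 < 1) :
    0 < (d * μ - 1) * (μ - d) := by
  have := h.density_pos
  have := h.speed_pos
  rw [← h.density_mul]
  exact mul_pos (by positivity) (sub_pos.2 hd)

lemma sqrt_mul_boost (h : IsHugoniotRatio d R y μ) (hd : d ^ 2 < 1) :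
    √(R * y) = |d * μ - 1| / √(1 - d ^ 2) := by
  rw [← Real.sqrt_sq_eq_abs, ← Real.sqrt_div (sq_nonneg _), ← h.mul_boost,
    mul_div_cancel_right₀ _ (sub_pos.2 hd).ne']

lemma sqrt_div_boost (h : IsHugoniotRatio d R y μ) (hd : d ^ 2 < 1) :
    √(R / y) = |μ - d| / (μ * √(1 - d ^ 2)) := by
  have hμ := h.speed_pos
  have hpos : 0 < μ ^ 2 * (1 - d ^ 2) := mul_pos (by positivity) (sub_pos.2 hd)
  rw [← Real.sqrt_sq_eq_abs, ← Real.sqrt_sq hμ.le, ← Real.sqrt_mul (sq_nonneg _),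
    Real.sqrt_sq hμ.le, ← Real.sqrt_div (sq_nonneg _), ← h.div_boost,
    mul_div_cancel_right₀ _ hpos.ne']

lemma rpow_mul_abs_sub_abs_le (h : IsHugoniotRatio d R y μ) (hd : d ^ 2 < 1)
    (hent : μ * (R ^ (d / 2) * √(R / y) - 1) ≤ R ^ (d / 2) * √(R * y) - 1) :
    R ^ (d / 2) * (|μ - d| - |d * μ - 1|) ≤ (μ - 1) * √(1 - d ^ 2) := by
  have hμ := h.speed_pos
  have hs : 0 < √(1 - d ^ 2) := Real.sqrt_pos.2 (sub_pos.2 hd)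
  rw [h.sqrt_mul_boost hd, h.sqrt_div_boost hd] at hent
  generalize R ^ (d / 2) = P, √(1 - d ^ 2) = s at *
  have hscaled := mul_le_mul_of_nonneg_right hent hs.le
  have hleft : μ * (P * (|μ - d| / (μ * s)) - 1) * s = P * |μ - d| - μ * s := by field_simp
  have hright : (P * (|d * μ - 1| / s) - 1) * s = P * |d * μ - 1| - s := by field_simp
  rw [hleft, hright] at hscaled
  linarith

-- The Padé approximant enters since it is the quotient which `density_mul` yields for
-- `((μ - 1) / (μ + 1)) ^ 2`.
lemma pade_sub_rpow (h : IsHugoniotRatio d R y μ) (hd : d ^ 2 < 1) :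
    ((1 - d) * (1 + μ)) ^ 2 * ((1 + d) * R + (1 - d) - R ^ d * ((1 - d) * R + (1 + d))) =
      ((1 - d) * R + (1 + d)) *
        (((μ - 1) * √(1 - d ^ 2)) ^ 2 - (R ^ (d / 2) * ((1 - d) * (1 + μ))) ^ 2) := by
  rw [mul_pow (μ - 1), mul_pow (R ^ (d / 2)), ← Real.rpow_mul_natCast h.density_pos.le,
    Nat.cast_two, div_mul_cancel₀ d two_ne_zero, Real.sq_sqrt (sub_pos.2 hd).le]
  linear_combination 4 * (1 - d) * h.density_mul

lemma density_lt_one (h : IsHugoniotRatio d R y μ) (hd0 : 0 < d) (hd1 : d < 1)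
    (hent : μ * (R ^ (d / 2) * √(R / y) - 1) ≤ R ^ (d / 2) * √(R * y) - 1) (hμ : 1 < d * μ) :
    R < 1 := by
  have hd : d ^ 2 < 1 := by nlinarith
  have hμd : d < μ := sub_pos.1 (pos_of_mul_pos_right (h.mul_pos_of_sq_lt_one hd) (by linarith))
  have hE : 0 < (1 - d) * (1 + μ) := mul_pos (by linarith) (by linarith)
  have hden : 0 < (1 - d) * R + (1 + d) := by nlinarith [h.density_pos]
  have hdiss := h.rpow_mul_abs_sub_abs_le hd hent
  rw [abs_of_pos (sub_pos.2 hμd), abs_of_pos (sub_pos.2 hμ),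
    show μ - d - (d * μ - 1) = (1 - d) * (1 + μ) by ring] at hdiss
  have hsq := pow_le_pow_left₀ (mul_pos (Real.rpow_pos_of_pos h.density_pos _) hE).le hdiss 2
  refine h.density_ne_one.lt_of_le (le_of_not_gt fun hR => ?_)
  have hneg := mul_neg_of_pos_of_neg (pow_pos hE 2) (sub_neg.2 (pade_lt_rpow hd0 hd1 hR))
  rw [h.pade_sub_rpow hd] at hneg
  exact hneg.not_ge (mul_nonneg hden.le (sub_nonneg.2 hsq))

lemma one_lt_density (h : IsHugoniotRatio d R y μ) (hd0 : 0 < d) (hd1 : d < 1)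
    (hent : μ * (R ^ (d / 2) * √(R / y) - 1) ≤ R ^ (d / 2) * √(R * y) - 1) (hμ : d * μ < 1) :
    1 < R := by
  have hd : d ^ 2 < 1 := by nlinarith
  have hμd : μ < d := sub_neg.1 (neg_of_mul_pos_right (h.mul_pos_of_sq_lt_one hd) (by linarith))
  have hE : 0 < (1 - d) * (1 + μ) := mul_pos (by linarith) (by linarith [h.speed_pos])
  have hden : 0 < (1 - d) * R + (1 + d) := by nlinarith [h.density_pos]
  have hdiss := h.rpow_mul_abs_sub_abs_le hd hent
  rw [abs_of_neg (sub_neg.2 hμd), abs_of_neg (sub_neg.2 hμ),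
    show -(μ - d) - -(d * μ - 1) = -((1 - d) * (1 + μ)) by ring, mul_neg, neg_le] at hdiss
  have hnonneg : 0 ≤ -((μ - 1) * √(1 - d ^ 2)) :=
    neg_nonneg.2 (mul_nonpos_of_nonpos_of_nonneg (by linarith) (Real.sqrt_nonneg _))
  have hsq := pow_le_pow_left₀ hnonneg hdiss 2
  rw [neg_sq] at hsq
  refine h.density_ne_one.symm.lt_of_le (le_of_not_gt fun hR => ?_)
  have hpos := mul_pos (pow_pos hE 2) (sub_pos.2 (rpow_lt_pade hd0 hd1 h.density_pos hR))
  rw [h.pade_sub_rpow hd] at hpos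
  exact hpos.not_ge (mul_nonpos_of_nonneg_of_nonpos hden.le (sub_nonpos.2 hsq))

lemma sonicBoost_mul_lt_one (h : IsHugoniotRatio (nullCoeff ε) R y μ) (hε : 0 < ε) (hε1 : ε < 1)
    (hent : μ * (R ^ (nullCoeff ε / 2) * √(R / y) - 1) ≤
      R ^ (nullCoeff ε / 2) * √(R * y) - 1) : sonicBoost ε * μ < 1 := by
  have hκ := sonicBoost_pos hε hε1
  have hκ1 := sonicBoost_lt_one hε
  have hd0 := nullCoeff_pos hε hε1
  have hd1 := nullCoeff_lt_one hε
  have hd : nullCoeff ε ^ 2 < 1 := by nlinarith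
  have hne := h.mul_pos_of_sq_lt_one hd
  rcases lt_trichotomy (nullCoeff ε * μ) 1 with hμ | hμ | hμ
  · have hμd : μ < nullCoeff ε := by nlinarith
    nlinarith [h.speed_pos]
  · simp [hμ] at hne
  · have hR := h.density_lt_one hd0 hd1 hent hμ
    have hneg := mul_neg_of_neg_of_pos (sub_neg.2 hR) (mul_pos h.speed_pos (sub_pos.2 hd))
    rw [h.density_sub_one_mul] at hneg
    have hfactor : (nullCoeff ε * μ ^ 2 - 2 * μ + nullCoeff ε) * (1 + sonicBoost ε ^ 2) =
        2 * ((sonicBoost ε * μ - 1) * (μ - sonicBoost ε)) := by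
      linear_combination (μ ^ 2 + 1) * nullCoeff_mul hε
    have hμκ : sonicBoost ε < μ := by nlinarith
    have hprod : (sonicBoost ε * μ - 1) * (μ - sonicBoost ε) < 0 := by
      nlinarith [mul_neg_of_neg_of_pos hneg (by positivity : 0 < 1 + sonicBoost ε ^ 2)]
    exact sub_neg.1 (neg_of_mul_neg_left hprod (sub_pos.2 hμκ).le)

lemma boost_le_one (h : IsHugoniotRatio d R y μ) (hd0 : 0 < d) (hd1 : d < 1)
    (hent : μ * (R ^ (d / 2) * √(R / y) - 1) ≤ R ^ (d / 2) * √(R * y) - 1) : y ≤ 1 := by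
  have hd : d ^ 2 < 1 := by nlinarith
  have hpos : 0 < μ * (1 - d ^ 2) := mul_pos h.speed_pos (sub_pos.2 hd)
  have hsub := h.boost_sub_one_mul hd
  have hprod := h.mul_pos_of_sq_lt_one hd
  by_contra! hy
  rcases lt_trichotomy (d * μ) 1 with hμ | hμ | hμ
  · have hμd : μ - d < 0 := neg_of_mul_pos_right hprod (by linarith)
    linarith [mul_neg_of_pos_of_neg (sub_pos.2 hy) hμd,
      mul_pos (sub_pos.2 (h.one_lt_density hd0 hd1 hent hμ)) hpos]
  · simp [hμ] at hprod
  · have hμd : 0 < μ - d := pos_of_mul_pos_right hprod (by linarith)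
    linarith [mul_pos (sub_pos.2 hy) hμd,
      mul_neg_of_neg_of_pos (sub_neg.2 (h.density_lt_one hd0 hd1 hent hμ)) hpos]

lemma rpow_tameExponent_mul_le_one (h : IsHugoniotRatio (nullCoeff ε) R y μ) (hε : 0 < ε)
    (hε1 : ε < 1) (hent : μ * (R ^ (nullCoeff ε / 2) * √(R / y) - 1) ≤
      R ^ (nullCoeff ε / 2) * √(R * y) - 1) : R ^ tameExponent ε * y ≤ 1 := by
  have hy := h.boost_le_one (nullCoeff_pos hε hε1) (nullCoeff_lt_one hε) hent
  rcases le_total 1 R with hR | hR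
  · refine rpow_mul_le_one_of_sq_eq (tameExponent_pos hε).le (tameExponent_le_one ε) hR
      h.boost_pos hy ?_
    rw [tameExponent_sq hε, h.sq_boost_sub_one]
  · exact mul_le_one₀ (Real.rpow_le_one h.density_pos.le hR (tameExponent_pos hε).le)
      h.boost_pos.le hy

end IsHugoniotRatio

/-- Triples `(ρ, ρ y, ρ / y)` with `ρ ≥ 0` and `y > 0`, all entries being zero in the vacuum: the
values of the null variables. -/
structure IsNullTriple (p : ℝ × ℝ × ℝ) : Prop where
  nonneg : 0 ≤ p.1
  mul_eq : p.2.1 * p.2.2 = p.1 ^ 2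
  pos : 0 < p.1 → 0 < p.2.1 ∧ 0 < p.2.2
  vacuum : p.1 = 0 → p.2.1 = 0 ∧ p.2.2 = 0

/-- The Rankine-Hugoniot relations in the null variables, for a jump from `a` to `b` with speed
`s`, together with the entropy inequality of the particle number. -/
structure IsNullJump (ε s : ℝ) (a b : ℝ × ℝ × ℝ) : Prop where
  left : IsNullTriple a
  right : IsNullTriple b
  plus : (1 - ε * s) * (b.2.1 - a.2.1) = (1 + ε * s) * nullCoeff ε * (b.1 - a.1)
  minus : (1 - ε * s) * nullCoeff ε * (b.1 - a.1) = (1 + ε * s) * (b.2.2 - a.2.2)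
  entropy : (1 + ε * s) * (b.1 ^ (nullCoeff ε / 2) * √b.2.2 - a.1 ^ (nullCoeff ε / 2) * √a.2.2) ≤
    (1 - ε * s) * (b.1 ^ (nullCoeff ε / 2) * √b.2.1 - a.1 ^ (nullCoeff ε / 2) * √a.2.1)

/-- At a non-vacuum state, positive if and only if the second characteristic speed exceeds `ξ`. -/
def speedGap₂ (ε ξ : ℝ) (p : ℝ × ℝ × ℝ) : ℝ :=
  (1 - ε * ξ) * p.2.1 - sonicBoost ε * (1 + ε * ξ) * p.1

/-- The Riemann invariant that is constant across simple waves of the first family. -/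
def riemannInvariant (ε : ℝ) (p : ℝ × ℝ × ℝ) : ℝ := p.1 ^ (tameExponent ε - 1) * p.2.1

/-- The effect of the reflection `x ↦ -x` on the null variables. -/
def reflect (p : ℝ × ℝ × ℝ) : ℝ × ℝ × ℝ := (p.1, p.2.2, p.2.1)

variable {s : ℝ} {a b : ℝ × ℝ × ℝ}

namespace IsNullTriple

lemma reflect (h : IsNullTriple a) : IsNullTriple (reflect a) :=
  ⟨h.nonneg, (mul_comm _ _).trans h.mul_eq, fun ha => (h.pos ha).symm,
    fun ha => (h.vacuum ha).symm⟩

lemma plus_nonneg (h : IsNullTriple a) : 0 ≤ a.2.1 := by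
  rcases h.nonneg.eq_or_lt with ha | ha
  · exact (h.vacuum ha.symm).1.ge
  · exact (h.pos ha).1.le

lemma density_le (ha : IsNullTriple a) (hb : IsNullTriple b) (hplus : a.2.1 ≤ b.2.1)
    (hminus : a.2.2 ≤ b.2.2) : a.1 ≤ b.1 := by
  rw [← pow_le_pow_iff_left₀ ha.nonneg hb.nonneg two_ne_zero, ← ha.mul_eq, ← hb.mul_eq]
  exact mul_le_mul hplus hminus ha.reflect.plus_nonneg hb.plus_nonneg

lemma ext_plus (ha : IsNullTriple a) (hb : IsNullTriple b) (hdensity : a.1 = b.1)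
    (hplus : a.2.1 = b.2.1) : a = b := by
  refine Prod.ext hdensity (Prod.ext hplus ?_)
  rcases ha.nonneg.eq_or_lt with h0 | h0
  · rw [(ha.vacuum h0.symm).2, (hb.vacuum (hdensity ▸ h0.symm)).2]
  · apply mul_left_cancel₀ (ha.pos h0).1.ne'
    rw [ha.mul_eq, hplus, hb.mul_eq, hdensity]

lemma sqrt_minus_mul_sqrt_plus (h : IsNullTriple a) : √a.2.2 * √a.2.1 = a.1 := by
  rw [← Real.sqrt_mul' _ h.plus_nonneg, mul_comm, h.mul_eq, Real.sqrt_sq h.nonneg]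

lemma density_div_mul_boost_div (ha : IsNullTriple a) (hb : IsNullTriple b) (ha0 : 0 < a.1)
    (hb0 : 0 < b.1) : b.1 / a.1 * ((b.2.1 / b.1) / (a.2.1 / a.1)) = b.2.1 / a.2.1 := by
  have := (ha.pos ha0).1
  have := (hb.pos hb0).1
  field_simp

lemma density_div_div_boost_div (ha : IsNullTriple a) (hb : IsNullTriple b) (ha0 : 0 < a.1)
    (hb0 : 0 < b.1) : b.1 / a.1 / ((b.2.1 / b.1) / (a.2.1 / a.1)) = b.2.2 / a.2.2 := by
  obtain ⟨-, ha_minus⟩ := ha.pos ha0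
  obtain ⟨hb_plus, -⟩ := hb.pos hb0
  field_simp
  rw [← ha.mul_eq, ← hb.mul_eq]
  ring

end IsNullTriple

namespace IsNullJump

lemma reflect (h : IsNullJump ε s a b) : IsNullJump ε (-s) (reflect b) (reflect a) where
  left := h.right.reflect
  right := h.left.reflect
  plus := by simp only [RelEuler.reflect]; linear_combination h.minus
  minus := by simp only [RelEuler.reflect]; linear_combination h.plus
  entropy := by simp only [RelEuler.reflect]; linarith [h.entropy]

lemma eq_of_density_eq (h : IsNullJump ε s a b) (hab : a.1 = b.1) : a = b := by
  have hplus := h.plus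
  have hminus := h.minus
  rw [hab, sub_self, mul_zero] at hplus hminus
  by_cases hs : 1 - ε * s = 0
  · have hs' : 1 + ε * s ≠ 0 := by linarith
    have hminus_eq : b.2.2 = a.2.2 := sub_eq_zero.1 ((mul_eq_zero.1 hminus.symm).resolve_left hs')
    have hreflect := h.left.reflect.ext_plus h.right.reflect hab hminus_eq.symm
    exact congrArg RelEuler.reflect hreflect
  · have hplus_eq : b.2.1 = a.2.1 := sub_eq_zero.1 ((mul_eq_zero.1 hplus).resolve_left hs)
    exact h.left.ext_plus h.right hab hplus_eq.symm

lemma one_sub_mul_ne_zero (h : IsNullJump ε s a b) (hε : 0 < ε) (hε1 : ε < 1) (hab : a.1 ≠ b.1) :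
    1 - ε * s ≠ 0 := by
  intro hs
  have hplus := h.plus
  rw [hs, zero_mul, show 1 + ε * s = 2 by linarith] at hplus
  have := nullCoeff_pos hε hε1
  exact mul_ne_zero (by positivity) (sub_ne_zero.2 hab.symm) hplus.symm

lemma subluminal (h : IsNullJump ε s a b) (hε : 0 < ε) (hε1 : ε < 1) (hab : a.1 ≠ b.1) :
    0 < 1 - ε * s ∧ 0 < 1 + ε * s := by
  have hs := h.one_sub_mul_ne_zero hε hε1 hab
  have hs' : 1 + ε * s ≠ 0 := by simpa using h.reflect.one_sub_mul_ne_zero hε hε1 hab.symm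
  suffices hprod : 0 < (1 - ε * s) * (1 + ε * s) by
    rcases pos_and_pos_or_neg_and_neg_of_mul_pos hprod with hpos | hneg
    · exact hpos
    · linarith
  by_contra! hprod
  have hd := nullCoeff_pos hε hε1
  -- At a superluminal speed both null components would move against the density.
  have hplus : (1 - ε * s) ^ 2 * (b.2.1 - a.2.1) =
      (1 - ε * s) * (1 + ε * s) * (nullCoeff ε * (b.1 - a.1)) := by
    linear_combination (1 - ε * s) * h.plus
  have hminus : (1 + ε * s) ^ 2 * (b.2.2 - a.2.2) =
      (1 - ε * s) * (1 + ε * s) * (nullCoeff ε * (b.1 - a.1)) := by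
    linear_combination -(1 + ε * s) * h.minus
  rcases hab.lt_or_gt with hlt | hgt
  · have hnonpos := mul_nonpos_of_nonpos_of_nonneg hprod (mul_pos hd (sub_pos.2 hlt)).le
    refine hlt.not_ge (h.right.density_le h.left (sub_nonpos.1 ?_) (sub_nonpos.1 ?_))
    · exact nonpos_of_mul_nonpos_right (hplus ▸ hnonpos) (by positivity)
    · exact nonpos_of_mul_nonpos_right (hminus ▸ hnonpos) (by positivity)
  · have hnonneg := mul_nonneg_of_nonpos_of_nonpos hprod
      (mul_neg_of_pos_of_neg hd (sub_neg.2 hgt)).le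
    refine hgt.not_ge (h.left.density_le h.right (sub_nonneg.1 ?_) (sub_nonneg.1 ?_))
    · exact nonneg_of_mul_nonneg_right (hplus ▸ hnonneg) (by positivity)
    · exact nonneg_of_mul_nonneg_right (hminus ▸ hnonneg) (by positivity)

lemma density_left_pos (h : IsNullJump ε s a b) (hε : 0 < ε) (hε1 : ε < 1) (hb : 0 < b.1) :
    0 < a.1 := by
  refine h.left.nonneg.lt_of_ne' fun ha => ?_
  obtain ⟨hs, hs'⟩ := h.subluminal hε hε1 (ha ▸ hb.ne)
  obtain ⟨ha_plus, ha_minus⟩ := h.left.vacuum ha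
  have hplus := h.plus
  have hminus := h.minus
  rw [ha, ha_plus, sub_zero, sub_zero] at hplus
  rw [ha, ha_minus, sub_zero, sub_zero] at hminus
  have hd : 0 < 1 - nullCoeff ε ^ 2 := by nlinarith [nullCoeff_pos hε hε1, nullCoeff_lt_one hε]
  have hzero : (1 - ε * s) * (1 + ε * s) * b.1 ^ 2 * (1 - nullCoeff ε ^ 2) = 0 := by
    linear_combination (1 + ε * s) * b.2.2 * hplus -
      (1 - ε * s) * (1 + ε * s) * h.right.mul_eq - (1 + ε * s) * nullCoeff ε * b.1 * hminus
  exact (by positivity : (1 - ε * s) * (1 + ε * s) * b.1 ^ 2 * (1 - nullCoeff ε ^ 2) ≠ 0) hzero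

lemma density_right_pos (h : IsNullJump ε s a b) (hε : 0 < ε) (hε1 : ε < 1) (ha : 0 < a.1) :
    0 < b.1 :=
  h.reflect.density_left_pos hε hε1 ha

lemma isHugoniotRatio (h : IsNullJump ε s a b) (hε : 0 < ε) (hε1 : ε < 1) (ha : 0 < a.1)
    (hab : a.1 ≠ b.1) : IsHugoniotRatio (nullCoeff ε) (b.1 / a.1)
      ((b.2.1 / b.1) / (a.2.1 / a.1)) (boost ε s / (a.2.1 / a.1)) := by
  have hb := h.density_right_pos hε hε1 ha
  obtain ⟨ha_plus, ha_minus⟩ := h.left.pos ha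
  obtain ⟨hb_plus, -⟩ := h.right.pos hb
  obtain ⟨hs, hs'⟩ := h.subluminal hε hε1 hab
  have hboost : 0 < boost ε s := div_pos hs' hs
  refine ⟨by positivity, ?_, by positivity, by positivity, ?_, ?_⟩
  · rw [Ne, div_eq_one_iff_eq ha.ne']
    exact hab.symm
  · rw [h.left.density_div_mul_boost_div h.right ha hb, boost]
    field_simp
    linear_combination h.plus
  · rw [h.left.density_div_div_boost_div h.right ha hb, boost]
    field_simp
    linear_combination a.2.1 * a.2.2 * h.minus +
      (1 + ε * s) * (b.2.2 - a.2.2) * h.left.mul_eq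

lemma entropy_ratio (h : IsNullJump ε s a b) (hε : 0 < ε) (hε1 : ε < 1) (ha : 0 < a.1)
    (hab : a.1 ≠ b.1) :
    boost ε s / (a.2.1 / a.1) * ((b.1 / a.1) ^ (nullCoeff ε / 2) *
        √(b.1 / a.1 / ((b.2.1 / b.1) / (a.2.1 / a.1))) - 1) ≤
      (b.1 / a.1) ^ (nullCoeff ε / 2) *
        √(b.1 / a.1 * ((b.2.1 / b.1) / (a.2.1 / a.1))) - 1 := by
  have hb := h.density_right_pos hε hε1 ha
  obtain ⟨ha_plus, ha_minus⟩ := h.left.pos ha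
  obtain ⟨hs, -⟩ := h.subluminal hε hε1 hab
  rw [h.left.density_div_mul_boost_div h.right ha hb,
    h.left.density_div_div_boost_div h.right ha hb,
    Real.div_rpow hb.le ha.le, Real.sqrt_div (h.right.pos hb).1.le,
    Real.sqrt_div (h.right.pos hb).2.le]
  have hent := h.entropy
  have hpow : 0 < a.1 ^ (nullCoeff ε / 2) := Real.rpow_pos_of_pos ha _
  generalize a.1 ^ (nullCoeff ε / 2) = A, b.1 ^ (nullCoeff ε / 2) = B at *
  have hspeed : boost ε s / (a.2.1 / a.1) = (1 + ε * s) * √a.2.2 / ((1 - ε * s) * √a.2.1) := by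
    rw [boost, ← h.left.sqrt_minus_mul_sqrt_plus]
    nth_rw 1 [← Real.sq_sqrt ha_plus.le]
    field_simp
  have hscale : 0 < (1 - ε * s) * A * √a.2.1 := by positivity
  refine le_of_mul_le_mul_left (hent.trans' (le_of_eq ?_) |>.trans (le_of_eq ?_)) hscale
  · rw [hspeed]
    field_simp
  · field_simp

-- The Lax entropy condition.
lemma speedGap₂_pos (h : IsNullJump ε s a b) (hε : 0 < ε) (hε1 : ε < 1) (ha : 0 < a.1)
    (hab : a ≠ b) : 0 < speedGap₂ ε s a := by
  have hdensity : a.1 ≠ b.1 := fun h' => hab (h.eq_of_density_eq h')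
  obtain ⟨ha_plus, -⟩ := h.left.pos ha
  obtain ⟨hs, -⟩ := h.subluminal hε hε1 hdensity
  have hlt := (h.isHugoniotRatio hε hε1 ha hdensity).sonicBoost_mul_lt_one hε hε1
    (h.entropy_ratio hε hε1 ha hdensity)
  rw [boost] at hlt
  field_simp at hlt
  rw [speedGap₂]
  linarith

lemma riemannInvariant_le (h : IsNullJump ε s a b) (hε : 0 < ε) (hε1 : ε < 1) (ha : 0 < a.1) :
    riemannInvariant ε b ≤ riemannInvariant ε a := by
  by_cases hdensity : a.1 = b.1
  · rw [h.eq_of_density_eq hdensity]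
  have hb := h.density_right_pos hε hε1 ha
  have ha_plus := (h.left.pos ha).1
  have hle := (h.isHugoniotRatio hε hε1 ha hdensity).rpow_tameExponent_mul_le_one hε hε1
    (h.entropy_ratio hε hε1 ha hdensity)
  rw [Real.div_rpow hb.le ha.le] at hle
  rw [riemannInvariant, riemannInvariant, Real.rpow_sub_one ha.ne', Real.rpow_sub_one hb.ne']
  have hpow : 0 < a.1 ^ tameExponent ε := Real.rpow_pos_of_pos ha _
  field_simp at hle ⊢
  linarith

end IsNullJump

end NullJumps

/-! ### The particle number -/

/-- The particle number density `ρ ^ (1 / (1 + ε²)) / √(1 - ε² v²)`, an additional conserved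
quantity of smooth solutions, with current `particleNumber ε u * u.2`. Its opposite is the convex
entropy on which the study of shocks rests. -/
def particleNumber (ε : ℝ) (u : ℝ × ℝ) : ℝ :=
  u.1 ^ (1 / (1 + ε ^ 2)) * (1 - ε ^ 2 * u.2 ^ 2) ^ (-(1 / 2) : ℝ)

/-- The differential, at the state `w`, of the particle number as a function of the conservative
variables, applied to the vector `p`. -/
def particleNumberDiff (ε : ℝ) (w p : ℝ × ℝ) : ℝ :=
  1 / (2 * (1 + ε ^ 2)) * w.1 ^ ((1 + nullCoeff ε) / 2 - 1) *
    ((p.1 + ε * p.2) / √(boost ε w.2) + (p.1 - ε * p.2) * √(boost ε w.2))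

/-- The particle number as a function of the conservative variables. -/
def particleNumberOf (ε : ℝ) (p : ℝ × ℝ) : ℝ :=
  particleNumber ε (densityOf ε p, p.2 / (p.1 + ε ^ 2 * densityOf ε p))

section Concavity

variable {ε v : ℝ} {u w : ℝ × ℝ}

lemma one_le_weighted_sum_rpow {d x q : ℝ} (hd0 : 0 ≤ d) (hd1 : d ≤ 1) (hx : 0 < x)
    (hq : 0 < q) :
    1 ≤ (1 - d) / 2 * (x ^ ((1 + d) / 2) * q) + 1 / 2 * (x ^ ((1 + d) / 2 - 1) / q) +
      d / 2 * (x ^ ((1 + d) / 2 - 1) * q) := by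
  -- AM-GM: the weighted geometric mean of the three terms is `1`.
  have hamgm := Real.geom_mean_le_arith_mean3_weighted (w₁ := (1 - d) / 2) (w₂ := 1 / 2)
    (w₃ := d / 2) (p₁ := x ^ ((1 + d) / 2) * q) (p₂ := x ^ ((1 + d) / 2 - 1) / q)
    (p₃ := x ^ ((1 + d) / 2 - 1) * q) (by linarith) (by norm_num) (by linarith)
    (by positivity) (by positivity) (by positivity) (by ring)
  refine le_trans (le_of_eq ?_) hamgm
  obtain ⟨a, rfl⟩ : ∃ a, x = Real.exp a := ⟨Real.log x, (Real.exp_log hx).symm⟩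
  obtain ⟨b, rfl⟩ : ∃ b, q = Real.exp b := ⟨Real.log q, (Real.exp_log hq).symm⟩
  rw [← Real.exp_mul, ← Real.exp_mul, ← Real.exp_add, ← Real.exp_sub, ← Real.exp_add,
    ← Real.exp_mul, ← Real.exp_mul, ← Real.exp_mul, ← Real.exp_add, ← Real.exp_add,
    eq_comm, Real.exp_eq_one_iff]
  ring

lemma rpow_mul_le_tangent {d ρ r g k : ℝ} (hd0 : 0 ≤ d) (hd1 : d ≤ 1) (hρ : 0 < ρ) (hr : 0 < r)
    (hg : 0 < g) (hk : 0 < k) :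
    ρ ^ ((1 + d) / 2) * g ≤ (1 - d) / 2 * (r ^ ((1 + d) / 2) * k) +
      1 / 2 * r ^ ((1 + d) / 2 - 1) * ρ * (g ^ 2 / k + d * k) := by
  have hone := one_le_weighted_sum_rpow hd0 hd1 (div_pos hr hρ) (div_pos hk hg)
  rw [Real.div_rpow hr.le hρ.le, Real.div_rpow hr.le hρ.le, Real.rpow_sub_one hρ.ne'] at hone
  have hpow : 0 < ρ ^ ((1 + d) / 2) := Real.rpow_pos_of_pos hρ _
  generalize r ^ ((1 + d) / 2) = a at *
  generalize ρ ^ ((1 + d) / 2) = b at *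
  generalize r ^ ((1 + d) / 2 - 1) = c at *
  calc b * g = b * g * 1 := (mul_one _).symm
    _ ≤ _ := mul_le_mul_of_nonneg_left hone (mul_pos hpow hg).le
    _ = _ := by field_simp; ring

lemma one_add_nullCoeff_div_two : (1 + nullCoeff ε) / 2 = 1 / (1 + ε ^ 2) := by
  rw [nullCoeff]; field_simp; ring

lemma sqrt_boost (hε : 0 < ε) (hv : ε * |v| < 1) :
    √(boost ε v) = (1 + ε * v) * (1 - ε ^ 2 * v ^ 2) ^ (-(1 / 2) : ℝ) := by
  have hplus := one_add_mul_pos hε hv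
  have hminus := one_sub_mul_pos hε hv
  rw [Real.rpow_neg (one_sub_sq_mul_sq_pos hε hv).le, ← Real.sqrt_eq_rpow, one_sub_sq_mul_sq,
    Real.sqrt_mul hminus.le, boost, Real.sqrt_div hplus.le]
  field_simp
  exact Real.sq_sqrt hplus.le

lemma inv_sqrt_boost (hε : 0 < ε) (hv : ε * |v| < 1) :
    (√(boost ε v))⁻¹ = (1 - ε * v) * (1 - ε ^ 2 * v ^ 2) ^ (-(1 / 2) : ℝ) := by
  have h := sqrt_boost hε (v := -v) (by rwa [abs_neg])
  rwa [boost_neg, Real.sqrt_inv, neg_sq, mul_neg, ← sub_eq_add_neg] at h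

lemma particleNumber_eq (hε : 0 < ε) (hu : u ∈ interiorStates ε) :
    particleNumber ε u =
      u.1 ^ ((1 + nullCoeff ε) / 2) * (√(boost ε u.2) + (√(boost ε u.2))⁻¹) / 2 := by
  rw [inv_sqrt_boost hε hu.2, sqrt_boost hε hu.2, one_add_nullCoeff_div_two, particleNumber]; ring

lemma particleNumberDiff_cons (hε : 0 < ε) (hu : u ∈ interiorStates ε)
    (hw : w ∈ interiorStates ε) :
    particleNumberDiff ε w (cons ε u) = 1 / 4 * w.1 ^ ((1 + nullCoeff ε) / 2 - 1) * u.1 *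
      ((boost ε u.2 + nullCoeff ε) / √(boost ε w.2) +
        ((boost ε u.2)⁻¹ + nullCoeff ε) * √(boost ε w.2)) := by
  have hbu := boost_pos hε hu.2
  have hbw := Real.sqrt_pos.2 (boost_pos hε hw.2)
  simp only [particleNumberDiff, cons]
  rw [G_eq hε (interiorStates_subset_phaseSpace hu),
    mul_H_eq hε (interiorStates_subset_phaseSpace hu), nullCoeff]
  field_simp
  ring

lemma particleNumber_le_tangent (hε : 0 < ε) (hε1 : ε < 1) (hu : u ∈ interiorStates ε)
    (hw : w ∈ interiorStates ε) :
    particleNumber ε u ≤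
      (1 - nullCoeff ε) / 2 * particleNumber ε w + particleNumberDiff ε w (cons ε u) := by
  have hd0 := (nullCoeff_pos hε hε1).le
  have hd1 := (nullCoeff_lt_one hε).le
  have hbu := Real.sqrt_pos.2 (boost_pos hε hu.2)
  have hbw := Real.sqrt_pos.2 (boost_pos hε hw.2)
  have hplus := rpow_mul_le_tangent hd0 hd1 hu.1 hw.1 hbu hbw
  have hminus := rpow_mul_le_tangent hd0 hd1 hu.1 hw.1 (inv_pos.2 hbu) (inv_pos.2 hbw)
  rw [inv_pow, div_inv_eq_mul, Real.sq_sqrt (boost_pos hε hu.2).le] at hminus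
  rw [Real.sq_sqrt (boost_pos hε hu.2).le] at hplus
  rw [particleNumberDiff_cons hε hu hw, particleNumber_eq hε hu, particleNumber_eq hε hw]
  linear_combination (hplus + hminus) / 2

lemma particleNumberDiff_self (hε : 0 < ε) (hw : w ∈ interiorStates ε) :
    particleNumberDiff ε w (cons ε w) = (1 + nullCoeff ε) / 2 * particleNumber ε w := by
  have hb := Real.sqrt_pos.2 (boost_pos hε hw.2)
  have hsq := Real.sq_sqrt (boost_pos hε hw.2).le
  have hρ := hw.1
  rw [particleNumberDiff_cons hε hw hw, particleNumber_eq hε hw, Real.rpow_sub_one hρ.ne']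
  generalize √(boost ε w.2) = g at *
  rw [← hsq]
  field_simp
  ring

lemma particleNumberOf_cons (hε : 0 < ε) (hε1 : ε < 1) (hu : u ∈ interiorStates ε) :
    particleNumberOf ε (cons ε u) = particleNumber ε u := by
  have hden : 0 < G ε u + ε ^ 2 * u.1 :=
    add_pos_of_nonneg_of_pos (G_nonneg hε (interiorStates_subset_phaseSpace hu))
      (mul_pos (by positivity) hu.1)
  rw [particleNumberOf, densityOf_cons hε hε1 (interiorStates_subset_phaseSpace hu)]
  simp only [cons]
  rw [H_eq_mul hε hu, mul_div_cancel_right₀ _ hden.ne']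

lemma convex_momentum_cone (hε : 0 ≤ ε) : Convex ℝ {p : ℝ × ℝ | ε * |p.2| < p.1} := by
  have hconvex : ConvexOn ℝ Set.univ fun p : ℝ × ℝ => ε * |p.2| - p.1 :=
    ((convexOn_univ_norm.comp_linearMap (LinearMap.snd ℝ ℝ ℝ)).smul hε).sub
      ((LinearMap.fst ℝ ℝ ℝ).concaveOn convex_univ)
  simpa only [Set.mem_univ, true_and, sub_neg] using hconvex.convex_lt 0

lemma concaveOn_particleNumberOf (hε : 0 < ε) (hε1 : ε < 1) :
    ConcaveOn ℝ {p : ℝ × ℝ | ε * |p.2| < p.1} (particleNumberOf ε) := by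
  refine ⟨convex_momentum_cone hε.le, fun p hp q hq a b ha hb hab => ?_⟩
  obtain ⟨u, hu, rfl⟩ := exists_cons_eq hε hp
  obtain ⟨v, hv, rfl⟩ := exists_cons_eq hε hq
  obtain ⟨w, hw, hcons⟩ := exists_cons_eq hε (convex_momentum_cone hε.le hp hq ha hb hab)
  have hu_le := mul_le_mul_of_nonneg_left (particleNumber_le_tangent hε hε1 hu hw) ha
  have hv_le := mul_le_mul_of_nonneg_left (particleNumber_le_tangent hε hε1 hv hw) hb
  have hdiff : particleNumberDiff ε w (cons ε w) =
      a * particleNumberDiff ε w (cons ε u) + b * particleNumberDiff ε w (cons ε v) := by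
    rw [hcons]
    simp only [particleNumberDiff, Prod.fst_add, Prod.snd_add, Prod.smul_fst, Prod.smul_snd,
      smul_eq_mul]
    ring
  rw [particleNumberDiff_self hε hw] at hdiff
  rw [← hcons, particleNumberOf_cons hε hε1 hu, particleNumberOf_cons hε hε1 hv,
    particleNumberOf_cons hε hε1 hw, smul_eq_mul, smul_eq_mul]
  obtain rfl : b = 1 - a := by linarith
  linarith

end Concavity

section EntropyPair

variable {ε : ℝ} {u : ℝ × ℝ}

lemma hasFDerivAt_particleNumber (hε : 0 < ε) (hu : u ∈ interiorStates ε) :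
    HasFDerivAt (particleNumber ε) (particleNumber ε u •
      ((1 / ((1 + ε ^ 2) * u.1)) • ContinuousLinearMap.fst ℝ ℝ ℝ +
        (ε ^ 2 * u.2 / (1 - ε ^ 2 * u.2 ^ 2)) • ContinuousLinearMap.snd ℝ ℝ ℝ)) u := by
  have hlorentz := one_sub_sq_mul_sq_pos hε hu.2
  have hdensity : HasDerivAt (fun x : ℝ => x ^ (1 / (1 + ε ^ 2)))
      (1 / (1 + ε ^ 2) * u.1 ^ (1 / (1 + ε ^ 2) - 1)) u.1 :=
    Real.hasDerivAt_rpow_const (Or.inl hu.1.ne')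
  have hquad : HasDerivAt (fun v : ℝ => 1 - ε ^ 2 * v ^ 2) (-(ε ^ 2 * (2 * u.2))) u.2 := by
    simpa using ((hasDerivAt_pow 2 u.2).const_mul (ε ^ 2)).const_sub 1
  have hvelocity := hquad.rpow_const (p := -(1 / 2)) (Or.inl hlorentz.ne')
  refine ((hdensity.hasFDerivAt.comp u hasFDerivAt_fst).mul
    (hvelocity.hasFDerivAt.comp u hasFDerivAt_snd)).congr_fderiv ?_
  rw [Real.rpow_sub_one hu.1.ne', Real.rpow_sub_one hlorentz.ne', particleNumber]
  refine ContinuousLinearMap.ext fun p => ?_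
  simp only [Function.comp_apply, add_apply, smul_apply, ContinuousLinearMap.comp_apply,
    ContinuousLinearMap.coe_fst', ContinuousLinearMap.coe_snd',
    ContinuousLinearMap.toSpanSingleton_apply, smul_eq_mul]
  field_simp
  ring

lemma hasFDerivAt_particleNumber_mul_velocity (hε : 0 < ε) (hu : u ∈ interiorStates ε) :
    HasFDerivAt (fun u => particleNumber ε u * u.2) (particleNumber ε u •
      ((u.2 / ((1 + ε ^ 2) * u.1)) • ContinuousLinearMap.fst ℝ ℝ ℝ +
        (1 / (1 - ε ^ 2 * u.2 ^ 2)) • ContinuousLinearMap.snd ℝ ℝ ℝ)) u := by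
  have hminus : 1 - u.2 * ε ≠ 0 := mul_comm ε u.2 ▸ (one_sub_mul_pos hε hu.2).ne'
  have hplus : 1 + u.2 * ε ≠ 0 := mul_comm ε u.2 ▸ (one_add_mul_pos hε hu.2).ne'
  refine ((hasFDerivAt_particleNumber hε hu).mul hasFDerivAt_snd).congr_fderiv ?_
  rw [one_sub_sq_mul_sq]
  refine ContinuousLinearMap.ext fun p => ?_
  simp only [add_apply, smul_apply, ContinuousLinearMap.coe_fst', ContinuousLinearMap.coe_snd',
    smul_eq_mul]
  field_simp
  ring

lemma contDiffOn_particleNumber (hε : 0 < ε) :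
    ContDiffOn ℝ ∞ (particleNumber ε) (interiorStates ε) :=
  (contDiffOn_fst.rpow_const_of_ne fun _ hu => hu.1.ne').mul
    (ContDiffOn.rpow_const_of_ne (by fun_prop) fun _ hu => (one_sub_sq_mul_sq_pos hε hu.2).ne')

lemma particleNumber_eq_zero (hu : u.1 = 0) : particleNumber ε u = 0 := by
  have hexp : 1 / (1 + ε ^ 2) ≠ 0 := by positivity
  rw [particleNumber, hu, Real.zero_rpow hexp, zero_mul]

lemma tameRegion_subset_phaseSpace {M : ℝ} (hM : 0 < M) : tameRegion ε M ⊆ phaseSpace ε := by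
  refine fun u hu => ⟨hu.1, ?_, fun hρ => ?_⟩
  · linarith [hu.2.2, Real.rpow_nonneg (div_nonneg hu.1 hM.le) (tameExponent ε)]
  · linarith [hu.2.2, Real.rpow_pos_of_pos (div_pos hρ hM) (tameExponent ε)]

lemma particleNumber_nonneg (hε : 0 < ε) (hu : u ∈ phaseSpace ε) : 0 ≤ particleNumber ε u := by
  rcases mem_interiorStates_or_eq_zero hu with h | h
  · have := one_sub_sq_mul_sq_pos hε h.2
    have := h.1
    unfold particleNumber; positivity
  · rw [particleNumber_eq_zero h]

lemma particleNumber_le_of_mem_tameRegion {M : ℝ} (hε : 0 < ε) (hM : 0 < M)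
    (hu : u ∈ tameRegion ε M) :
    particleNumber ε u ≤ M ^ (1 / (1 + ε ^ 2)) *
      (u.1 / M) ^ (1 / (1 + ε ^ 2) - tameExponent ε / 2) := by
  rcases mem_interiorStates_or_eq_zero (tameRegion_subset_phaseSpace hM hu) with h | h
  swap
  · rw [particleNumber_eq_zero h, h]; positivity
  have hratio : 0 < u.1 / M := div_pos h.1 hM
  have htame : (u.1 / M) ^ tameExponent ε ≤ 1 - ε ^ 2 * u.2 ^ 2 := by
    refine hu.2.2.trans ?_
    have hsq : ε ^ 2 * u.2 ^ 2 = (ε * |u.2|) ^ 2 := by rw [mul_pow, sq_abs]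
    rw [hsq]
    nlinarith [h.2, (by positivity : 0 ≤ ε * |u.2|)]
  calc particleNumber ε u
      ≤ u.1 ^ (1 / (1 + ε ^ 2)) * ((u.1 / M) ^ tameExponent ε) ^ (-(1 / 2) : ℝ) :=
        mul_le_mul_of_nonneg_left
          (Real.rpow_le_rpow_of_nonpos (Real.rpow_pos_of_pos hratio _) htame (by norm_num))
          (Real.rpow_nonneg h.1.le _)
    _ = M ^ (1 / (1 + ε ^ 2)) * ((u.1 / M) ^ (1 / (1 + ε ^ 2)) *
          (u.1 / M) ^ (tameExponent ε * (-(1 / 2)))) := by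
        rw [← Real.rpow_mul hratio.le, ← mul_assoc, ← Real.mul_rpow hM.le hratio.le,
          mul_div_cancel₀ _ hM.ne']
    _ = _ := by rw [← Real.rpow_add hratio]; ring_nf

lemma continuousOn_particleNumber {M : ℝ} (hε : 0 < ε) (hε1 : ε < 1) (hM : 0 < M) :
    ContinuousOn (particleNumber ε) (tameRegion ε M) := by
  intro u hu
  rcases mem_interiorStates_or_eq_zero (tameRegion_subset_phaseSpace hM hu) with h | h
  · exact (hasFDerivAt_particleNumber hε h).continuousAt.continuousWithinAt
  have hexp : 0 < 1 / (1 + ε ^ 2) - tameExponent ε / 2 := by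
    have : 1 / (1 + ε ^ 2) - tameExponent ε / 2 = (1 - ε) / (1 + ε ^ 2) := by
      unfold tameExponent; ring
    exact this ▸ div_pos (sub_pos.2 hε1) (by positivity)
  have hbound : Tendsto (fun w : ℝ × ℝ => M ^ (1 / (1 + ε ^ 2)) *
      (w.1 / M) ^ (1 / (1 + ε ^ 2) - tameExponent ε / 2)) (𝓝[tameRegion ε M] u) (𝓝 0) := by
    have hcont : ContinuousAt (fun w : ℝ × ℝ => M ^ (1 / (1 + ε ^ 2)) *
        (w.1 / M) ^ (1 / (1 + ε ^ 2) - tameExponent ε / 2)) u :=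
      continuousAt_const.mul
        ((continuous_fst.div_const M).continuousAt.rpow_const (Or.inr hexp.le))
    simpa only [h, zero_div, Real.zero_rpow hexp.ne', mul_zero] using
      hcont.tendsto.mono_left nhdsWithin_le_nhds
  rw [ContinuousWithinAt, particleNumber_eq_zero h]
  refine tendsto_of_tendsto_of_tendsto_of_le_of_le' tendsto_const_nhds hbound ?_ ?_ <;>
    filter_upwards [self_mem_nhdsWithin] with w hw
  · exact particleNumber_nonneg hε (tameRegion_subset_phaseSpace hM hw)
  · exact particleNumber_le_of_mem_tameRegion hε hM hw

lemma mul_abs_sq_velocity_lt_one (hε : 0 < ε) (hε1 : ε < 1) (hu : u ∈ interiorStates ε) :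
    |ε ^ 2 * u.2| < 1 := by
  rw [abs_mul, abs_of_pos (by positivity : 0 < ε ^ 2), sq, mul_assoc]
  exact mul_lt_one_of_nonneg_of_lt_one_left hε.le hε1 hu.2.le

lemma particleNumber_compat₁ (hε : 0 < ε) (hε1 : ε < 1) (hu : u ∈ interiorStates ε) :
    fderiv ℝ (fun u => particleNumber ε u * u.2) u (r₁ ε u) =
      lam₁ ε u * fderiv ℝ (particleNumber ε) u (r₁ ε u) := by
  have hminus : 1 - u.2 * ε ≠ 0 := mul_comm ε u.2 ▸ (one_sub_mul_pos hε hu.2).ne'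
  have hplus : 1 + u.2 * ε ≠ 0 := mul_comm ε u.2 ▸ (one_add_mul_pos hε hu.2).ne'
  have hspeed : 1 - u.2 * ε ^ 2 ≠ 0 := by
    linarith [(abs_lt.1 (mul_abs_sq_velocity_lt_one hε hε1 hu)).2]
  have hρ := hu.1.ne'
  rw [(hasFDerivAt_particleNumber hε hu).fderiv,
    (hasFDerivAt_particleNumber_mul_velocity hε hu).fderiv]
  simp only [r₁, lam₁, one_sub_sq_mul_sq, smul_apply, add_apply, smul_eq_mul,
    ContinuousLinearMap.coe_fst', ContinuousLinearMap.coe_snd']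
  field_simp
  ring

lemma particleNumber_compat₂ (hε : 0 < ε) (hε1 : ε < 1) (hu : u ∈ interiorStates ε) :
    fderiv ℝ (fun u => particleNumber ε u * u.2) u (r₂ ε u) =
      lam₂ ε u * fderiv ℝ (particleNumber ε) u (r₂ ε u) := by
  have hminus : 1 - u.2 * ε ≠ 0 := mul_comm ε u.2 ▸ (one_sub_mul_pos hε hu.2).ne'
  have hplus : 1 + u.2 * ε ≠ 0 := mul_comm ε u.2 ▸ (one_add_mul_pos hε hu.2).ne'
  have hspeed : 1 + u.2 * ε ^ 2 ≠ 0 := by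
    linarith [(abs_lt.1 (mul_abs_sq_velocity_lt_one hε hε1 hu)).1]
  have hρ := hu.1.ne'
  rw [(hasFDerivAt_particleNumber hε hu).fderiv,
    (hasFDerivAt_particleNumber_mul_velocity hε hu).fderiv]
  simp only [r₂, lam₂, one_sub_sq_mul_sq, smul_apply, add_apply, smul_eq_mul,
    ContinuousLinearMap.coe_fst', ContinuousLinearMap.coe_snd']
  field_simp

lemma isConvexWeakEntropyPair_neg_particleNumber (hε : 0 < ε) (hε1 : ε < 1) :
    IsConvexWeakEntropyPair ε (fun u => -particleNumber ε u)
      (fun u => -(particleNumber ε u * u.2)) where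
  smooth_U := (contDiffOn_particleNumber hε).neg
  smooth_Q := ((contDiffOn_particleNumber hε).mul contDiffOn_snd).neg
  compat₁ u hu := by
    rw [fderiv_fun_neg, fderiv_fun_neg, neg_apply, neg_apply,
      particleNumber_compat₁ hε hε1 hu, mul_neg]
  compat₂ u hu := by
    rw [fderiv_fun_neg, fderiv_fun_neg, neg_apply, neg_apply,
      particleNumber_compat₂ hε hε1 hu, mul_neg]
  continuousOn_U _ hM := (continuousOn_particleNumber hε hε1 hM).neg
  continuousOn_Q _ hM := ((continuousOn_particleNumber hε hε1 hM).mul continuousOn_snd).neg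
  vacuum v _ := by simp [particleNumber_eq_zero (ε := ε) (u := (0, v)) rfl]
  convex := ⟨-particleNumberOf ε, (concaveOn_particleNumberOf hε hε1).neg, fun u hu => by
    rw [Pi.neg_apply, particleNumberOf_cons hε hε1 hu]⟩

end EntropyPair

section Jumps

variable {ε : ℝ} {u : ℝ × ℝ}

lemma rpow_nullCoeff_div_two_mul_sqrt {ρ : ℝ} (hρ : 0 < ρ) :
    ρ ^ (nullCoeff ε / 2) * √ρ = ρ ^ (1 / (1 + ε ^ 2)) := by
  rw [Real.sqrt_eq_rpow, ← Real.rpow_add hρ, ← one_add_nullCoeff_div_two]; ring_nf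

lemma particleNumber_mul_one_add (hε : 0 < ε) (hu : u ∈ phaseSpace ε) :
    particleNumber ε u * (1 + ε * u.2) =
      (nullState ε u).1 ^ (nullCoeff ε / 2) * √(nullState ε u).2.1 := by
  rcases mem_interiorStates_or_eq_zero hu with h | h
  · rw [nullState, Real.sqrt_mul hu.1, sqrt_boost hε h.2, particleNumber,
      ← rpow_nullCoeff_div_two_mul_sqrt h.1]
    ring
  · simp [particleNumber_eq_zero h, nullState, h]

lemma particleNumber_mul_one_sub (hε : 0 < ε) (hu : u ∈ phaseSpace ε) :
    particleNumber ε u * (1 - ε * u.2) =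
      (nullState ε u).1 ^ (nullCoeff ε / 2) * √(nullState ε u).2.2 := by
  rcases mem_interiorStates_or_eq_zero hu with h | h
  · rw [nullState, div_eq_mul_inv u.1, Real.sqrt_mul hu.1, Real.sqrt_inv, inv_sqrt_boost hε h.2,
      particleNumber, ← rpow_nullCoeff_div_two_mul_sqrt h.1]
    ring
  · simp [particleNumber_eq_zero h, nullState, h]

lemma isNullTriple_nullState (hε : 0 < ε) (hu : u ∈ phaseSpace ε) :
    IsNullTriple (nullState ε u) := by
  rcases mem_interiorStates_or_eq_zero hu with h | h
  · have hb := boost_pos hε h.2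
    have hρ := h.1
    refine ⟨hu.1, ?_, fun _ => ⟨?_, ?_⟩, fun h' => absurd h' h.1.ne'⟩ <;> simp only [nullState]
    · field_simp
    · positivity
    · positivity
  · refine ⟨hu.1, ?_, fun h' => absurd h h'.ne', fun _ => ?_⟩ <;> simp [nullState, h]

lemma IsEntropyJump.isNullJump {s : ℝ} {a b : ℝ × ℝ} (hε : 0 < ε) (hε1 : ε < 1)
    (ha : a ∈ phaseSpace ε) (hb : b ∈ phaseSpace ε) (h : IsEntropyJump ε s a b) :
    IsNullJump ε s (nullState ε a) (nullState ε b) := by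
  obtain ⟨hmass, hmomentum, hentropy⟩ := h
  have hnumber := hentropy _ _ (isConvexWeakEntropyPair_neg_particleNumber hε hε1)
  refine ⟨isNullTriple_nullState hε ha, isNullTriple_nullState hε hb, ?_, ?_, ?_⟩
  · simp only [nullState, nullCoeff]
    field_simp
    linear_combination
      (1 - ε * s) * (density_mul_boost_eq hε hb - density_mul_boost_eq hε ha) -
      (1 + ε * s) * (density_eq hε hb - density_eq hε ha) + 2 * ε * hmass + 2 * ε ^ 2 * hmomentum
  · simp only [nullState, nullCoeff]
    field_simp
    linear_combination
      (1 - ε * s) * (density_eq hε hb - density_eq hε ha) -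
      (1 + ε * s) * (density_div_boost_eq hε hb - density_div_boost_eq hε ha) +
      2 * ε * hmass - 2 * ε ^ 2 * hmomentum
  · rw [← particleNumber_mul_one_add hε ha, ← particleNumber_mul_one_sub hε ha,
      ← particleNumber_mul_one_add hε hb, ← particleNumber_mul_one_sub hε hb]
    linarith [mul_le_mul_of_nonneg_left hnumber (by positivity : 0 ≤ 2 * ε)]

end Jumps

/-! ### Self-similar solutions in the null variables -/

/-- At a non-vacuum state, positive if and only if the first characteristic speed exceeds `ξ`. -/
def speedGap₁ (ε ξ : ℝ) (p : ℝ × ℝ × ℝ) : ℝ :=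
  sonicBoost ε * (1 - ε * ξ) * p.2.1 - (1 + ε * ξ) * p.1

/-- Self-similar solutions, with admissible jumps and only finitely many, contained in `S`, in the
null variables. The conservation laws make the derivative at `ξ` proportional to a vector that
depends on `ξ` only; `γ ξ` is the factor. -/
structure IsNullProfile (ε : ℝ) (U : ℝ → ℝ × ℝ × ℝ) (γ : ℝ → ℝ) (S : Finset ℝ) : Prop where
  isNullTriple : ∀ ξ, IsNullTriple (U ξ)
  continuousAt_rate : ∀ ξ, ξ ∉ S → ContinuousAt γ ξ
  density : ∀ ξ, ξ ∉ S →
    HasDerivAt (fun η => (U η).1) ((1 + ε * ξ) * (1 - ε * ξ) * γ ξ) ξ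
  plus : ∀ ξ, ξ ∉ S →
    HasDerivAt (fun η => (U η).2.1) (nullCoeff ε * (1 + ε * ξ) ^ 2 * γ ξ) ξ
  minus : ∀ ξ, ξ ∉ S →
    HasDerivAt (fun η => (U η).2.2) (nullCoeff ε * (1 - ε * ξ) ^ 2 * γ ξ) ξ
  jump : ∀ s, ∃ a b, Tendsto U (𝓝[<] s) (𝓝 a) ∧ Tendsto U (𝓝[>] s) (𝓝 b) ∧
    (U s = a ∨ U s = b) ∧ IsNullJump ε s a b

section Coefficients

variable {ε : ℝ}

lemma one_sub_tameExponent (hε : 0 < ε) : 1 - tameExponent ε = nullCoeff ε * sonicBoost ε := by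
  simp only [tameExponent, nullCoeff, sonicBoost]; field_simp; ring

lemma sonicBoost_lt_nullCoeff (hε : 0 < ε) (hε1 : ε < 1) : sonicBoost ε < nullCoeff ε := by
  have hκ := sonicBoost_pos hε hε1
  have hκ1 := sonicBoost_lt_one hε
  have hmul := nullCoeff_mul hε
  have hsq : sonicBoost ε ^ 2 < 1 := pow_lt_one₀ hκ.le hκ1 two_ne_zero
  have hκ3 := mul_lt_mul_of_pos_left hsq hκ
  refine lt_of_mul_lt_mul_right (?_ : _ * (1 + sonicBoost ε ^ 2) < _) (by positivity)
  linarith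

lemma sonicBoost_mul_nullCoeff_lt_one (hε : 0 < ε) : sonicBoost ε * nullCoeff ε < 1 := by
  rw [mul_comm, ← one_sub_tameExponent hε]
  linarith [tameExponent_pos hε]

lemma pos_and_pos_of_mul_eq_mul {A B x y : ℝ} (hA : 0 < A) (hB : 0 < B) (hxy : 0 < x + y)
    (h : A * x = B * y) : 0 < x ∧ 0 < y := by
  have hx : 0 < x := by
    by_contra! hx
    have hBy : 0 < B * y := mul_pos hB (by linarith)
    linarith [mul_nonpos_of_nonneg_of_nonpos hA.le hx]
  exact ⟨hx, pos_of_mul_pos_right (h ▸ mul_pos hA hx) hB.le⟩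

lemma speedGap₁_neg_of_speedGap₂_nonpos {ξ : ℝ} {p : ℝ × ℝ × ℝ} (hε : 0 < ε) (hε1 : ε < 1)
    (hp : IsNullTriple p) (hpos : 0 < p.1) (hgap : speedGap₂ ε ξ p ≤ 0) :
    speedGap₁ ε ξ p < 0 := by
  have hκ := sonicBoost_pos hε hε1
  have hκ_sq : 0 < 1 - sonicBoost ε ^ 2 :=
    sub_pos.2 (pow_lt_one₀ hκ.le (sonicBoost_lt_one hε) two_ne_zero)
  have hplus := (hp.pos hpos).1
  have hξ : 0 < 1 + ε * ξ := by
    by_contra! hξ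
    have h₁ : 0 < (1 - ε * ξ) * p.2.1 := mul_pos (by linarith) hplus
    have h₂ : sonicBoost ε * (1 + ε * ξ) * p.1 ≤ 0 :=
      mul_nonpos_of_nonpos_of_nonneg (mul_nonpos_of_nonneg_of_nonpos hκ.le hξ) hpos.le
    rw [speedGap₂] at hgap
    linarith
  calc speedGap₁ ε ξ p
      = sonicBoost ε * speedGap₂ ε ξ p - (1 - sonicBoost ε ^ 2) * ((1 + ε * ξ) * p.1) := by
        rw [speedGap₁, speedGap₂]; ring
    _ < 0 := by
        linarith [mul_nonpos_of_nonneg_of_nonpos hκ.le hgap,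
          mul_pos hκ_sq (mul_pos hξ hpos)]

lemma IsNullJump.left_of_right {s : ℝ} {a b : ℝ × ℝ × ℝ} (h : IsNullJump ε s a b) (hε : 0 < ε)
    (hε1 : ε < 1) (hpos : 0 < b.1) (hgap : 0 < speedGap₂ ε s b) :
    0 < a.1 ∧ 0 < speedGap₂ ε s a ∧ riemannInvariant ε b ≤ riemannInvariant ε a := by
  have ha := h.density_left_pos hε hε1 hpos
  refine ⟨ha, ?_, h.riemannInvariant_le hε hε1 ha⟩
  by_cases hab : a = b
  · rwa [hab]
  · exact h.speedGap₂_pos hε hε1 ha hab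

end Coefficients

section Limits

lemma continuous_reflect : Continuous reflect := by unfold reflect; fun_prop

variable {ε t : ℝ} {U : ℝ → ℝ × ℝ × ℝ} {l : Filter ℝ} {b : ℝ × ℝ × ℝ}

lemma tendsto_density (hU : Tendsto U l (𝓝 b)) : Tendsto (fun x => (U x).1) l (𝓝 b.1) :=
  (continuous_fst.tendsto b).comp hU

lemma tendsto_riemannInvariant (hU : Tendsto U l (𝓝 b)) (hb : 0 < b.1) :
    Tendsto (fun x => riemannInvariant ε (U x)) l (𝓝 (riemannInvariant ε b)) :=
  ((tendsto_density hU).rpow_const (Or.inl hb.ne')).mul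
    (((continuous_fst.comp continuous_snd).tendsto b).comp hU)

lemma tendsto_speedGap₂ (hl : l ≤ 𝓝 t) (hU : Tendsto U l (𝓝 b)) :
    Tendsto (fun x => speedGap₂ ε x (U x)) l (𝓝 (speedGap₂ ε t b)) := by
  have hcont : Continuous fun q : ℝ × (ℝ × ℝ × ℝ) => speedGap₂ ε q.1 q.2 := by
    unfold speedGap₂; fun_prop
  exact (hcont.tendsto (t, b)).comp (f := fun x => (x, U x)) ((tendsto_id'.2 hl).prodMk_nhds hU)

lemma eventually_notMem_nhdsGT (S : Finset ℝ) (t : ℝ) : ∀ᶠ x in 𝓝[>] t, x ∉ S :=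
  S.eventually_cofinite_notMem.filter_mono ((nhdsGT_le_nhdsNE t).trans (nhdsNE_le_cofinite t))

lemma eventually_notMem_nhdsLT (S : Finset ℝ) (t : ℝ) : ∀ᶠ x in 𝓝[<] t, x ∉ S :=
  S.eventually_cofinite_notMem.filter_mono ((nhdsLT_le_nhdsNE t).trans (nhdsNE_le_cofinite t))

end Limits

namespace IsNullProfile

variable {ε : ℝ} {U : ℝ → ℝ × ℝ × ℝ} {γ : ℝ → ℝ} {S : Finset ℝ}

section Rate

variable {ξ : ℝ}

lemma hasDerivAt_speedGap₂ (h : IsNullProfile ε U γ S) (hξ : ξ ∉ S) :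
    HasDerivAt (fun η => speedGap₂ ε η (U η))
      ((nullCoeff ε - sonicBoost ε) * ((1 + ε * ξ) ^ 2 * (1 - ε * ξ)) * γ ξ -
        ε * ((U ξ).2.1 + sonicBoost ε * (U ξ).1)) ξ := by
  have hminus : HasDerivAt (fun η : ℝ => 1 - ε * η) (-(ε * 1)) ξ :=
    ((hasDerivAt_id ξ).const_mul ε).const_sub 1
  have hplus : HasDerivAt (fun η : ℝ => sonicBoost ε * (1 + ε * η)) (sonicBoost ε * (ε * 1)) ξ :=
    (((hasDerivAt_id ξ).const_mul ε).const_add 1).const_mul (sonicBoost ε)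
  exact ((hminus.mul (h.plus ξ hξ)).sub (hplus.mul (h.density ξ hξ))).congr_deriv (by ring)

lemma hasDerivAt_speedGap₁ (h : IsNullProfile ε U γ S) (hξ : ξ ∉ S) :
    HasDerivAt (fun η => speedGap₁ ε η (U η))
      (-((1 - sonicBoost ε * nullCoeff ε) * ((1 + ε * ξ) ^ 2 * (1 - ε * ξ)) * γ ξ) -
        ε * (sonicBoost ε * (U ξ).2.1 + (U ξ).1)) ξ := by
  have hminus : HasDerivAt (fun η : ℝ => sonicBoost ε * (1 - ε * η))
      (sonicBoost ε * -(ε * 1)) ξ :=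
    (((hasDerivAt_id ξ).const_mul ε).const_sub 1).const_mul (sonicBoost ε)
  have hplus : HasDerivAt (fun η : ℝ => 1 + ε * η) (ε * 1) ξ :=
    ((hasDerivAt_id ξ).const_mul ε).const_add 1
  exact ((hminus.mul (h.plus ξ hξ)).sub (hplus.mul (h.density ξ hξ))).congr_deriv (by ring)

lemma hasDerivAt_riemannInvariant (h : IsNullProfile ε U γ S) (hε : 0 < ε) (hξ : ξ ∉ S)
    (hpos : 0 < (U ξ).1) :
    HasDerivAt (fun η => riemannInvariant ε (U η))
      (-((U ξ).1 ^ (tameExponent ε - 2) * nullCoeff ε * (1 + ε * ξ) *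
        (γ ξ * speedGap₁ ε ξ (U ξ)))) ξ := by
  refine (((h.density ξ hξ).rpow_const (p := tameExponent ε - 1) (Or.inl hpos.ne')).mul
    (h.plus ξ hξ)).congr_deriv ?_
  have hexp : tameExponent ε - 1 - 1 = tameExponent ε - 2 := by ring
  have hpow : (U ξ).1 ^ (tameExponent ε - 1) = (U ξ).1 ^ (tameExponent ε - 2) * (U ξ).1 := by
    rw [← Real.rpow_add_one hpos.ne']; ring_nf
  rw [hexp, hpow, speedGap₁]
  linear_combination -((U ξ).1 ^ (tameExponent ε - 2) * ((1 + ε * ξ) * (1 - ε * ξ) * γ ξ) *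
    (U ξ).2.1) * one_sub_tameExponent hε

lemma rate_mul_speedGap (h : IsNullProfile ε U γ S) (hε : 0 < ε) (hε1 : ε < 1) (hξ : ξ ∉ S) :
    γ ξ * (speedGap₂ ε ξ (U ξ) * speedGap₁ ε ξ (U ξ)) = 0 := by
  -- Differentiate the relation `(ρ y) (ρ / y) = ρ²`.
  have hrel : (fun η => (U η).2.1) * (fun η => (U η).2.2) = (fun η => (U η).1) ^ 2 :=
    funext fun η => (h.isNullTriple η).mul_eq
  have hderiv := ((h.plus ξ hξ).mul (h.minus ξ hξ)).unique (hrel ▸ (h.density ξ hξ).pow 2)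
  simp only [Nat.cast_ofNat, Nat.add_one_sub_one, pow_one] at hderiv
  refine (mul_eq_zero.1 ?_).resolve_left (nullCoeff_pos hε hε1).ne'
  rw [speedGap₁, speedGap₂]
  linear_combination sonicBoost ε * (U ξ).2.1 * hderiv -
    sonicBoost ε * nullCoeff ε * (1 + ε * ξ) ^ 2 * γ ξ * (h.isNullTriple ξ).mul_eq -
    (1 + ε * ξ) * (1 - ε * ξ) * γ ξ * (U ξ).1 * (U ξ).2.1 * nullCoeff_mul hε

lemma lightCone_of_rate_ne_zero (h : IsNullProfile ε U γ S) (hε : 0 < ε) (hε1 : ε < 1)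
    (hξ : ξ ∉ S) (hpos : 0 < (U ξ).1) (hγ : γ ξ ≠ 0) : 0 < 1 - ε * ξ ∧ 0 < 1 + ε * ξ := by
  have hκ := sonicBoost_pos hε hε1
  have hplus := ((h.isNullTriple ξ).pos hpos).1
  have hsum : 0 < (1 - ε * ξ) + (1 + ε * ξ) := by linarith
  rcases mul_eq_zero.1 ((mul_eq_zero.1 (h.rate_mul_speedGap hε hε1 hξ)).resolve_left hγ)
    with hgap | hgap
  · rw [speedGap₂] at hgap
    exact pos_and_pos_of_mul_eq_mul hplus (mul_pos hκ hpos) hsum (by linarith)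
  · rw [speedGap₁] at hgap
    exact pos_and_pos_of_mul_eq_mul (mul_pos hκ hplus) hpos hsum (by linarith)

lemma eventually_rate_ne_zero (h : IsNullProfile ε U γ S) (hξ : ξ ∉ S) (hγ : γ ξ ≠ 0) :
    ∀ᶠ η in 𝓝 ξ, η ∉ S ∧ γ η ≠ 0 :=
  (S.isClosed.isOpen_compl.eventually_mem hξ).and ((h.continuousAt_rate ξ hξ).eventually_ne hγ)

-- Near a point where `γ` does not vanish, one of the gaps does; its derivative gives the sign.
lemma rate_nonneg (h : IsNullProfile ε U γ S) (hε : 0 < ε) (hε1 : ε < 1) (hξ : ξ ∉ S)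
    (hpos : 0 < (U ξ).1) (hgap : speedGap₂ ε ξ (U ξ) ≤ 0) : 0 ≤ γ ξ := by
  by_cases hγ : γ ξ = 0
  · exact hγ.ge
  have hκ := sonicBoost_pos hε hε1
  have hplus := ((h.isNullTriple ξ).pos hpos).1
  have hgap₁ := speedGap₁_neg_of_speedGap₂_nonpos hε hε1 (h.isNullTriple ξ) hpos hgap
  have hgap₂ : ∀ᶠ η in 𝓝 ξ, speedGap₂ ε η (U η) = 0 := by
    filter_upwards [h.eventually_rate_ne_zero hξ hγ,
      (h.hasDerivAt_speedGap₁ hξ).continuousAt.eventually_lt_const hgap₁] with η hη hη₁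
    exact (mul_eq_zero.1 ((mul_eq_zero.1 (h.rate_mul_speedGap hε hε1 hη.1)).resolve_left
      hη.2)).resolve_right hη₁.ne
  have hderiv := (h.hasDerivAt_speedGap₂ hξ).unique
    ((hasDerivAt_const ξ (0 : ℝ)).congr_of_eventuallyEq hgap₂)
  obtain ⟨hξ₁, hξ₂⟩ := h.lightCone_of_rate_ne_zero hε hε1 hξ hpos hγ
  have hcoeff : 0 < (nullCoeff ε - sonicBoost ε) * ((1 + ε * ξ) ^ 2 * (1 - ε * ξ)) :=
    mul_pos (sub_pos.2 (sonicBoost_lt_nullCoeff hε hε1)) (by positivity)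
  have hsource : 0 < ε * ((U ξ).2.1 + sonicBoost ε * (U ξ).1) := by positivity
  exact (pos_of_mul_pos_right (sub_eq_zero.1 hderiv ▸ hsource) hcoeff.le).le

lemma rate_nonpos (h : IsNullProfile ε U γ S) (hε : 0 < ε) (hε1 : ε < 1) (hξ : ξ ∉ S)
    (hpos : 0 < (U ξ).1) (hgap : 0 < speedGap₂ ε ξ (U ξ)) : γ ξ ≤ 0 := by
  by_cases hγ : γ ξ = 0
  · exact hγ.le
  have hκ := sonicBoost_pos hε hε1
  have hplus := ((h.isNullTriple ξ).pos hpos).1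
  have hgap₁ : ∀ᶠ η in 𝓝 ξ, speedGap₁ ε η (U η) = 0 := by
    filter_upwards [h.eventually_rate_ne_zero hξ hγ,
      (h.hasDerivAt_speedGap₂ hξ).continuousAt.eventually_const_lt hgap] with η hη hη₂
    exact (mul_eq_zero.1 ((mul_eq_zero.1 (h.rate_mul_speedGap hε hε1 hη.1)).resolve_left
      hη.2)).resolve_left hη₂.ne'
  have hderiv := (h.hasDerivAt_speedGap₁ hξ).unique
    ((hasDerivAt_const ξ (0 : ℝ)).congr_of_eventuallyEq hgap₁)
  obtain ⟨hξ₁, hξ₂⟩ := h.lightCone_of_rate_ne_zero hε hε1 hξ hpos hγ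
  have hcoeff : 0 < (1 - sonicBoost ε * nullCoeff ε) * ((1 + ε * ξ) ^ 2 * (1 - ε * ξ)) :=
    mul_pos (sub_pos.2 (sonicBoost_mul_nullCoeff_lt_one hε)) (by positivity)
  have hsource : 0 < ε * (sonicBoost ε * (U ξ).2.1 + (U ξ).1) := by positivity
  have hneg : 0 < -γ ξ := by
    refine pos_of_mul_pos_right (?_ : 0 < _ * -γ ξ) hcoeff.le
    rw [mul_neg, sub_eq_zero.1 hderiv]
    exact hsource
  linarith

lemma deriv_speedGap₂_neg (h : IsNullProfile ε U γ S) (hε : 0 < ε) (hε1 : ε < 1) (hξ : ξ ∉ S)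
    (hpos : 0 < (U ξ).1) (hgap : 0 < speedGap₂ ε ξ (U ξ)) :
    (nullCoeff ε - sonicBoost ε) * ((1 + ε * ξ) ^ 2 * (1 - ε * ξ)) * γ ξ -
      ε * ((U ξ).2.1 + sonicBoost ε * (U ξ).1) < 0 := by
  have hκ := sonicBoost_pos hε hε1
  have hplus := ((h.isNullTriple ξ).pos hpos).1
  have hsource : 0 < ε * ((U ξ).2.1 + sonicBoost ε * (U ξ).1) := by positivity
  rcases (h.rate_nonpos hε hε1 hξ hpos hgap).eq_or_lt with hγ | hγ
  · rw [hγ, mul_zero, zero_sub]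
    exact neg_neg_of_pos hsource
  · have hξ₁ := (h.lightCone_of_rate_ne_zero hε hε1 hξ hpos hγ.ne).1
    have hcoeff : 0 ≤ (nullCoeff ε - sonicBoost ε) * ((1 + ε * ξ) ^ 2 * (1 - ε * ξ)) :=
      mul_nonneg (sub_pos.2 (sonicBoost_lt_nullCoeff hε hε1)).le (by positivity)
    linarith [mul_nonpos_of_nonneg_of_nonpos hcoeff hγ.le]

end Rate

section Monotonicity

variable {p q : ℝ}

lemma monotoneOn_density (h : IsNullProfile ε U γ S) (hε : 0 < ε) (hε1 : ε < 1)
    (hI : ∀ x ∈ Set.Ioo p q, x ∉ S ∧ 0 < (U x).1 ∧ speedGap₂ ε x (U x) ≤ 0) :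
    MonotoneOn (fun x => (U x).1) (Set.Ioo p q) := by
  refine monotoneOn_of_hasDerivWithinAt_nonneg (convex_Ioo p q)
    (fun x hx => (h.density x (hI x hx).1).continuousAt.continuousWithinAt)
    (fun x hx => (h.density x (hI x (interior_subset hx)).1).hasDerivWithinAt) fun x hx => ?_
  obtain ⟨hxS, hpos, hgap⟩ := hI x (interior_subset hx)
  rcases (h.rate_nonneg hε hε1 hxS hpos hgap).eq_or_lt with hγ | hγ
  · rw [← hγ, mul_zero]
  · obtain ⟨hx₁, hx₂⟩ := h.lightCone_of_rate_ne_zero hε hε1 hxS hpos hγ.ne'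
    positivity

lemma monotoneOn_riemannInvariant (h : IsNullProfile ε U γ S) (hε : 0 < ε) (hε1 : ε < 1)
    (hI : ∀ x ∈ Set.Ioo p q, x ∉ S ∧ 0 < (U x).1 ∧ speedGap₂ ε x (U x) ≤ 0) :
    MonotoneOn (fun x => riemannInvariant ε (U x)) (Set.Ioo p q) := by
  have hderiv := fun x hx => h.hasDerivAt_riemannInvariant hε (hI x hx).1 (hI x hx).2.1
  refine monotoneOn_of_hasDerivWithinAt_nonneg (convex_Ioo p q)
    (fun x hx => (hderiv x hx).continuousAt.continuousWithinAt)
    (fun x hx => (hderiv x (interior_subset hx)).hasDerivWithinAt) fun x hx => ?_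
  obtain ⟨hxS, hpos, hgap⟩ := hI x (interior_subset hx)
  have hgap₁ := speedGap₁_neg_of_speedGap₂_nonpos hε hε1 (h.isNullTriple x) hpos hgap
  have hδ := nullCoeff_pos hε hε1
  rw [Left.nonneg_neg_iff]
  rcases (h.rate_nonneg hε hε1 hxS hpos hgap).eq_or_lt with hγ | hγ
  · rw [← hγ, zero_mul, mul_zero]
  · have hx₂ := (h.lightCone_of_rate_ne_zero hε hε1 hxS hpos hγ.ne').2
    exact mul_nonpos_of_nonneg_of_nonpos (by positivity)
      (mul_nonpos_of_nonneg_of_nonpos hγ.le hgap₁.le)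

lemma antitoneOn_density (h : IsNullProfile ε U γ S) (hε : 0 < ε) (hε1 : ε < 1)
    (hI : ∀ x ∈ Set.Ioo p q, x ∉ S ∧ 0 < (U x).1 ∧ 0 < speedGap₂ ε x (U x)) :
    AntitoneOn (fun x => (U x).1) (Set.Ioo p q) := by
  refine antitoneOn_of_hasDerivWithinAt_nonpos (convex_Ioo p q)
    (fun x hx => (h.density x (hI x hx).1).continuousAt.continuousWithinAt)
    (fun x hx => (h.density x (hI x (interior_subset hx)).1).hasDerivWithinAt) fun x hx => ?_
  obtain ⟨hxS, hpos, hgap⟩ := hI x (interior_subset hx)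
  rcases (h.rate_nonpos hε hε1 hxS hpos hgap).eq_or_lt with hγ | hγ
  · rw [hγ, mul_zero]
  · obtain ⟨hx₁, hx₂⟩ := h.lightCone_of_rate_ne_zero hε hε1 hxS hpos hγ.ne
    exact mul_nonpos_of_nonneg_of_nonpos (by positivity) hγ.le

-- The invariant is even constant: `γ` vanishes unless the first characteristic speed is `x`, and
-- the invariant has zero derivative in either case.
lemma antitoneOn_riemannInvariant (h : IsNullProfile ε U γ S) (hε : 0 < ε) (hε1 : ε < 1)
    (hI : ∀ x ∈ Set.Ioo p q, x ∉ S ∧ 0 < (U x).1 ∧ 0 < speedGap₂ ε x (U x)) :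
    AntitoneOn (fun x => riemannInvariant ε (U x)) (Set.Ioo p q) := by
  have hderiv := fun x hx => h.hasDerivAt_riemannInvariant hε (hI x hx).1 (hI x hx).2.1
  refine antitoneOn_of_hasDerivWithinAt_nonpos (convex_Ioo p q)
    (fun x hx => (hderiv x hx).continuousAt.continuousWithinAt)
    (fun x hx => (hderiv x (interior_subset hx)).hasDerivWithinAt) fun x hx => ?_
  obtain ⟨hxS, -, hgap⟩ := hI x (interior_subset hx)
  have hzero : speedGap₂ ε x (U x) * (γ x * speedGap₁ ε x (U x)) = 0 := by
    rw [mul_left_comm]; exact h.rate_mul_speedGap hε hε1 hxS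
  rw [(mul_eq_zero.1 hzero).resolve_left hgap.ne', mul_zero, neg_zero]

end Monotonicity

section OneSidedLimits

variable {t : ℝ} {b : ℝ × ℝ × ℝ}

lemma tendsto_nhdsGT (h : IsNullProfile ε U γ S) (hε : 0 < ε) (hε1 : ε < 1)
    (hpos : 0 < (U t).1) (hgap : speedGap₂ ε t (U t) ≤ 0) :
    Tendsto U (𝓝[>] t) (𝓝 (U t)) := by
  obtain ⟨a, b, -, hb, hU | hU, hjump⟩ := h.jump t
  · rw [hU] at hpos hgap ⊢
    by_contra hne
    exact hgap.not_gt (hjump.speedGap₂_pos hε hε1 hpos fun hab => hne (hab ▸ hb))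
  · rwa [hU]

lemma eq_of_tendsto_nhdsLT (h : IsNullProfile ε U γ S) (hε : 0 < ε) (hε1 : ε < 1)
    (hb : Tendsto U (𝓝[<] t) (𝓝 b)) (hpos : 0 < b.1) (hgap : speedGap₂ ε t b ≤ 0) : U t = b := by
  obtain ⟨a, c, ha, -, hU, hjump⟩ := h.jump t
  obtain rfl := tendsto_nhds_unique ha hb
  have hac : a = c := by
    by_contra hac
    exact hgap.not_gt (hjump.speedGap₂_pos hε hε1 hpos hac)
  exact hU.elim id fun hc => hc.trans hac.symm

-- Wherever the gap is positive it decreases, so it cannot become positive.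
lemma eventually_speedGap₂_nonpos (h : IsNullProfile ε U γ S) (hε : 0 < ε) (hε1 : ε < 1)
    (hb : Tendsto U (𝓝[>] t) (𝓝 b)) (hpos : 0 < b.1) (hgap : speedGap₂ ε t b ≤ 0) :
    ∀ᶠ x in 𝓝[>] t, speedGap₂ ε x (U x) ≤ 0 := by
  obtain ⟨q, htq, hq⟩ := mem_nhdsGT_iff_exists_Ioo_subset.1
    ((eventually_notMem_nhdsGT S t).and ((tendsto_density hb).eventually_const_lt hpos))
  filter_upwards [Ioo_mem_nhdsGT htq] with x hx
  by_contra! hx_gap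
  set η := speedGap₂ ε x (U x) / 2 with hη
  obtain ⟨y, hy_gap, hty, hyx⟩ : ∃ y, speedGap₂ ε y (U y) < η ∧ t < y ∧ y < x :=
    (((tendsto_speedGap₂ nhdsWithin_le_nhds hb).eventually_lt_const
      (hgap.trans_lt (half_pos hx_gap))).and (Ioo_mem_nhdsGT hx.1)).exists
  have hsub : ∀ z ∈ Set.Icc y x, z ∉ S ∧ 0 < (U z).1 := fun z hz =>
    hq ⟨hty.trans_le hz.1, hz.2.trans_lt hx.2⟩
  have hle : speedGap₂ ε x (U x) ≤ η :=
    image_le_of_deriv_right_lt_deriv_boundary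
      (fun z hz => (h.hasDerivAt_speedGap₂ (hsub z hz).1).continuousAt.continuousWithinAt)
      (fun z hz =>
        (h.hasDerivAt_speedGap₂ (hsub z (Set.Ico_subset_Icc_self hz)).1).hasDerivWithinAt)
      hy_gap.le (fun z => hasDerivAt_const z η)
      (fun z hz hz_gap => h.deriv_speedGap₂_neg hε hε1 (hsub z (Set.Ico_subset_Icc_self hz)).1
        (hsub z (Set.Ico_subset_Icc_self hz)).2 (hz_gap ▸ half_pos hx_gap))
      ⟨hyx.le, le_rfl⟩
  linarith

lemma eventually_nhdsGT (h : IsNullProfile ε U γ S) (hε : 0 < ε) (hε1 : ε < 1)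
    (hb : Tendsto U (𝓝[>] t) (𝓝 b)) (hpos : 0 < b.1) (hgap : speedGap₂ ε t b ≤ 0) :
    ∀ᶠ x in 𝓝[>] t, speedGap₂ ε x (U x) ≤ 0 ∧ b.1 ≤ (U x).1 ∧
      riemannInvariant ε b ≤ riemannInvariant ε (U x) := by
  obtain ⟨q, htq, hq⟩ := mem_nhdsGT_iff_exists_Ioo_subset.1
    ((eventually_notMem_nhdsGT S t).and (((tendsto_density hb).eventually_const_lt hpos).and
      (h.eventually_speedGap₂_nonpos hε hε1 hb hpos hgap)))
  filter_upwards [Ioo_mem_nhdsGT htq] with x hx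
  exact ⟨(hq hx).2.2,
    le_of_monotoneOn_Ioo_of_tendsto (h.monotoneOn_density hε hε1 fun y hy => hq hy)
      (tendsto_density hb) x hx,
    le_of_monotoneOn_Ioo_of_tendsto (h.monotoneOn_riemannInvariant hε hε1 fun y hy => hq hy)
      (tendsto_riemannInvariant hb hpos) x hx⟩

lemma eventually_nhdsLT (h : IsNullProfile ε U γ S) (hε : 0 < ε) (hε1 : ε < 1)
    (hb : Tendsto U (𝓝[<] t) (𝓝 b)) (hpos : 0 < b.1) (hgap : 0 < speedGap₂ ε t b) :
    ∀ᶠ x in 𝓝[<] t, 0 < (U x).1 ∧ 0 < speedGap₂ ε x (U x) ∧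
      riemannInvariant ε b ≤ riemannInvariant ε (U x) := by
  obtain ⟨q, hqt, hq⟩ := mem_nhdsLT_iff_exists_Ioo_subset.1
    ((eventually_notMem_nhdsLT S t).and (((tendsto_density hb).eventually_const_lt hpos).and
      ((tendsto_speedGap₂ nhdsWithin_le_nhds hb).eventually_const_lt hgap)))
  filter_upwards [Ioo_mem_nhdsLT hqt] with x hx
  refine ⟨(hq hx).2.1, (hq hx).2.2, le_of_tendsto (tendsto_riemannInvariant hb hpos) ?_⟩
  filter_upwards [Ioo_mem_nhdsLT hx.2] with y hy
  exact h.antitoneOn_riemannInvariant hε hε1 (fun y hy => hq hy) hx ⟨hx.1.trans hy.1, hy.2⟩ hy.1.le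

lemma right_limit_of_eventually (h : IsNullProfile ε U γ S) (hε : 0 < ε) (hε1 : ε < 1)
    (hb : Tendsto U (𝓝[>] t) (𝓝 b)) {c : ℝ}
    (hU : ∀ᶠ x in 𝓝[>] t, 0 < (U x).1 ∧ 0 < speedGap₂ ε x (U x) ∧
      c ≤ riemannInvariant ε (U x)) :
    0 < b.1 ∧ 0 < speedGap₂ ε t b ∧ c ≤ riemannInvariant ε b := by
  obtain ⟨q, htq, hq⟩ := mem_nhdsGT_iff_exists_Ioo_subset.1 ((eventually_notMem_nhdsGT S t).and hU)
  obtain ⟨x, hx⟩ := Set.nonempty_Ioo.2 (Set.mem_Ioi.1 htq)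
  have hpos : 0 < b.1 := (hq hx).2.1.trans_le <| le_of_antitoneOn_Ioo_of_tendsto
    (h.antitoneOn_density hε hε1 fun y hy => ⟨(hq hy).1, (hq hy).2.1, (hq hy).2.2.1⟩)
    (tendsto_density hb) x hx
  refine ⟨hpos, ?_, ge_of_tendsto (tendsto_riemannInvariant hb hpos) (hU.mono fun y hy => hy.2.2)⟩
  by_contra! hgap
  obtain ⟨y, hy_nonpos, hy⟩ := ((h.eventually_speedGap₂_nonpos hε hε1 hb hpos hgap).and hU).exists
  exact hy_nonpos.not_gt hy.2.1

end OneSidedLimits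

section Propagation

variable {ξ : ℝ}

lemma propagation_right (h : IsNullProfile ε U γ S) (hε : 0 < ε) (hε1 : ε < 1)
    (hpos : 0 < (U ξ).1) (hgap : speedGap₂ ε ξ (U ξ) ≤ 0) :
    ∀ x, ξ ≤ x → speedGap₂ ε x (U x) ≤ 0 ∧ (U ξ).1 ≤ (U x).1 ∧
      riemannInvariant ε (U ξ) ≤ riemannInvariant ε (U x) := by
  refine forall_ge_of_eventually_nhdsGT ⟨hgap, le_rfl, le_rfl⟩ ?_ ?_
  · rintro t - ⟨ht_gap, ht_density, ht_invariant⟩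
    have ht_pos := hpos.trans_le ht_density
    have hlimit := h.tendsto_nhdsGT hε hε1 ht_pos ht_gap
    filter_upwards [h.eventually_nhdsGT hε hε1 hlimit ht_pos ht_gap]
      with x hx
    exact ⟨hx.1, ht_density.trans hx.2.1, ht_invariant.trans hx.2.2⟩
  · intro t ht hlt
    obtain ⟨a, -, ha, -⟩ := h.jump t
    have hleft : ∀ᶠ x in 𝓝[<] t, speedGap₂ ε x (U x) ≤ 0 ∧ (U ξ).1 ≤ (U x).1 ∧
        riemannInvariant ε (U ξ) ≤ riemannInvariant ε (U x) := by
      filter_upwards [Ioo_mem_nhdsLT ht] with x hx using hlt x hx.1.le hx.2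
    have ha_density : (U ξ).1 ≤ a.1 :=
      ge_of_tendsto (tendsto_density ha) (hleft.mono fun x hx => hx.2.1)
    have ha_pos := hpos.trans_le ha_density
    have ha_gap : speedGap₂ ε t a ≤ 0 :=
      le_of_tendsto (tendsto_speedGap₂ nhdsWithin_le_nhds ha) (hleft.mono fun x hx => hx.1)
    rw [h.eq_of_tendsto_nhdsLT hε hε1 ha ha_pos ha_gap]
    exact ⟨ha_gap, ha_density,
      ge_of_tendsto (tendsto_riemannInvariant ha ha_pos) (hleft.mono fun x hx => hx.2.2)⟩

lemma propagation_left (h : IsNullProfile ε U γ S) (hε : 0 < ε) (hε1 : ε < 1)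
    (hpos : 0 < (U ξ).1) (hgap : 0 < speedGap₂ ε ξ (U ξ)) :
    ∀ x, x ≤ ξ → 0 < (U x).1 ∧ 0 < speedGap₂ ε x (U x) ∧
      riemannInvariant ε (U ξ) ≤ riemannInvariant ε (U x) := by
  refine forall_le_of_eventually_nhdsLT ⟨hpos, hgap, le_rfl⟩ ?_ ?_
  · rintro t - ⟨ht_pos, ht_gap, ht_invariant⟩
    obtain ⟨a, b, ha, -, hU, hjump⟩ := h.jump t
    obtain ⟨ha_pos, ha_gap, ha_invariant⟩ : 0 < a.1 ∧ 0 < speedGap₂ ε t a ∧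
        riemannInvariant ε (U t) ≤ riemannInvariant ε a := by
      rcases hU with hU | hU <;> rw [hU] at ht_pos ht_gap ⊢
      · exact ⟨ht_pos, ht_gap, le_rfl⟩
      · exact hjump.left_of_right hε hε1 ht_pos ht_gap
    filter_upwards [h.eventually_nhdsLT hε hε1 ha ha_pos ha_gap] with x hx
    exact ⟨hx.1, hx.2.1, (ht_invariant.trans ha_invariant).trans hx.2.2⟩
  · intro t ht hgt
    obtain ⟨a, b, -, hb, hU, hjump⟩ := h.jump t
    obtain ⟨hb_pos, hb_gap, hb_invariant⟩ := h.right_limit_of_eventually hε hε1 hb <| by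
      filter_upwards [Ioo_mem_nhdsGT ht] with x hx using hgt x hx.1 hx.2.le
    rcases hU with hU | hU <;> rw [hU]
    · obtain ⟨ha_pos, ha_gap, ha_invariant⟩ := hjump.left_of_right hε hε1 hb_pos hb_gap
      exact ⟨ha_pos, ha_gap, hb_invariant.trans ha_invariant⟩
    · exact ⟨hb_pos, hb_gap, hb_invariant⟩

lemma exists_density_le (h : IsNullProfile ε U γ S) (hε : 0 < ε) (hε1 : ε < 1)
    (hleft : ∀ x, x ≤ ξ → 0 < (U x).1 ∧ 0 < speedGap₂ ε x (U x)) :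
    ∃ c, 0 < c ∧ ∀ᶠ x in atBot, c ≤ (U x).1 := by
  obtain ⟨B, hB⟩ := S.bddBelow
  set q := min B ξ
  refine ⟨(U (q - 1)).1, (hleft _ (by linarith [min_le_right B ξ])).1, ?_⟩
  filter_upwards [eventually_lt_atBot (q - 1)] with x hx
  refine h.antitoneOn_density hε hε1 (p := x - 1) (q := q) (fun y hy => ⟨fun hyS => ?_, ?_⟩)
    ⟨by linarith, by linarith⟩ ⟨by linarith, by linarith⟩ hx.le
  · exact ((hB (Finset.mem_coe.2 hyS)).trans_lt (hy.2.trans_le (min_le_left B ξ))).false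
  · exact hleft y (hy.2.le.trans (min_le_right B ξ))

theorem riemannInvariant_le_data (h : IsNullProfile ε U γ S) (hε : 0 < ε) (hε1 : ε < 1)
    {a b : ℝ × ℝ × ℝ} (ha : Tendsto U atBot (𝓝 a)) (hb : Tendsto U atTop (𝓝 b))
    (hpos : 0 < (U ξ).1) :
    (0 < a.1 ∧ riemannInvariant ε (U ξ) ≤ riemannInvariant ε a) ∨
      (0 < b.1 ∧ riemannInvariant ε (U ξ) ≤ riemannInvariant ε b) := by
  rcases le_or_gt (speedGap₂ ε ξ (U ξ)) 0 with hgap | hgap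
  · have hright := (eventually_ge_atTop ξ).mono (h.propagation_right hε hε1 hpos hgap)
    have hb_pos : 0 < b.1 :=
      hpos.trans_le (ge_of_tendsto (tendsto_density hb) (hright.mono fun x hx => hx.2.1))
    exact Or.inr ⟨hb_pos,
      ge_of_tendsto (tendsto_riemannInvariant hb hb_pos) (hright.mono fun x hx => hx.2.2)⟩
  · have hleft := h.propagation_left hε hε1 hpos hgap
    obtain ⟨c, hc, hc_le⟩ := h.exists_density_le hε hε1 fun x hx =>
      ⟨(hleft x hx).1, (hleft x hx).2.1⟩
    have ha_pos : 0 < a.1 := hc.trans_le (ge_of_tendsto (tendsto_density ha) hc_le)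
    exact Or.inl ⟨ha_pos, ge_of_tendsto (tendsto_riemannInvariant ha ha_pos)
      ((eventually_le_atBot ξ).mono fun x hx => (hleft x hx).2.2)⟩

end Propagation

lemma reflect (h : IsNullProfile ε U γ S) :
    IsNullProfile ε (fun ξ => reflect (U (-ξ))) (fun ξ => -γ (-ξ)) (S.image Neg.neg) := by
  have hnotMem : ∀ ξ, ξ ∉ S.image Neg.neg → -ξ ∉ S := fun ξ hξ hS =>
    hξ (neg_neg ξ ▸ Finset.mem_image_of_mem Neg.neg hS)
  have hneg : ∀ {f : ℝ → ℝ} {f' ξ : ℝ}, HasDerivAt f f' (-ξ) →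
      HasDerivAt (fun η => f (-η)) (f' * -1) ξ := fun {f f' ξ} hf =>
    hf.comp ξ (hasDerivAt_neg ξ)
  refine ⟨fun ξ => (h.isNullTriple (-ξ)).reflect, fun ξ hξ => ?_, fun ξ hξ => ?_, fun ξ hξ => ?_,
    fun ξ hξ => ?_, fun s => ?_⟩
  · exact ((h.continuousAt_rate _ (hnotMem ξ hξ)).comp continuousAt_neg).neg
  · exact (hneg (h.density _ (hnotMem ξ hξ))).congr_deriv (by ring)
  · exact (hneg (h.minus _ (hnotMem ξ hξ))).congr_deriv (by ring)
  · exact (hneg (h.plus _ (hnotMem ξ hξ))).congr_deriv (by ring)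
  · obtain ⟨a, b, ha, hb, hU, hjump⟩ := h.jump (-s)
    exact ⟨RelEuler.reflect b, RelEuler.reflect a,
      (continuous_reflect.tendsto b).comp (hb.comp tendsto_neg_nhdsLT),
      (continuous_reflect.tendsto a).comp (ha.comp tendsto_neg_nhdsGT),
      hU.symm.imp (congrArg RelEuler.reflect) (congrArg RelEuler.reflect),
      neg_neg s ▸ hjump.reflect⟩

end IsNullProfile

/-! ### The invariant region of the Riemann problem -/

/-- The exponent of the boost factor in the Riemann invariants, written as
`ρ * boost ε v ^ boostExponent ε` and `ρ * boost ε (-v) ^ boostExponent ε`. -/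
def boostExponent (ε : ℝ) : ℝ := (1 + ε ^ 2) / (2 * ε)

/-- The region where both Riemann invariants are at most `M`; the larger of the two is the one with
the boost factor of `|v|`. -/
def invariantRegion (ε M : ℝ) : Set (ℝ × ℝ) :=
  {u | u ∈ phaseSpace ε ∧ (0 < u.1 → u.1 * boost ε |u.2| ^ boostExponent ε ≤ M)}

section BoostFactor

variable {ε v : ℝ}

lemma boostExponent_pos (hε : 0 < ε) : 0 < boostExponent ε := by unfold boostExponent; positivity

lemma one_lt_boostExponent (hε : 0 < ε) (hε1 : ε < 1) : 1 < boostExponent ε := by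
  rw [boostExponent, one_lt_div (by positivity)]
  linarith [sq_pos_of_pos (sub_pos.2 hε1)]

lemma boostExponent_mul_tameExponent (hε : 0 < ε) : boostExponent ε * tameExponent ε = 1 := by
  simp only [boostExponent, tameExponent]; field_simp

lemma one_le_boost_abs (hε : 0 < ε) (hv : ε * |v| < 1) : 1 ≤ boost ε |v| := by
  have hnonneg : 0 ≤ ε * |v| := by positivity
  rw [boost, one_le_div (by linarith)]
  linarith

lemma boost_le_boost_abs (hε : 0 < ε) (hv : ε * |v| < 1) : boost ε v ≤ boost ε |v| := by
  have hnonneg : 0 ≤ ε * |v| := by positivity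
  have hle : ε * v ≤ ε * |v| := mul_le_mul_of_nonneg_left (le_abs_self v) hε.le
  exact div_le_div₀ (by linarith) (by linarith) (by linarith) (by linarith)

lemma mul_boost_abs_rpow_le_iff {ρ M : ℝ} (hε : 0 < ε) (hρ : 0 ≤ ρ) (hv : ε * |v| < 1) :
    ρ * boost ε |v| ^ boostExponent ε ≤ M ↔
      ρ * boost ε v ^ boostExponent ε ≤ M ∧ ρ * boost ε (-v) ^ boostExponent ε ≤ M := by
  have hmono : ∀ w, ε * |w| < 1 →
      ρ * boost ε w ^ boostExponent ε ≤ ρ * boost ε |w| ^ boostExponent ε := fun w hw =>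
    mul_le_mul_of_nonneg_left (Real.rpow_le_rpow (boost_pos hε hw).le (boost_le_boost_abs hε hw)
      (boostExponent_pos hε).le) hρ
  refine ⟨fun h => ⟨(hmono v hv).trans h, ?_⟩, fun h => ?_⟩
  · rw [← abs_neg] at h hv
    exact (hmono (-v) hv).trans h
  · rcases abs_choice v with hv | hv <;> rw [hv]
    exacts [h.1, h.2]

end BoostFactor

section RiemannInvariants

variable {ε M : ℝ} {u : ℝ × ℝ}

lemma reflect_nullState (ε : ℝ) (u : ℝ × ℝ) :
    reflect (nullState ε u) = nullState ε (u.1, -u.2) := by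
  simp only [reflect, nullState, boost_neg, div_eq_mul_inv, inv_inv]

lemma riemannInvariant_nullState (hε : 0 < ε) (hu : u ∈ interiorStates ε) :
    riemannInvariant ε (nullState ε u) =
      (u.1 * boost ε u.2 ^ boostExponent ε) ^ tameExponent ε := by
  have hb := boost_pos hε hu.2
  rw [Real.mul_rpow hu.1.le (by positivity), ← Real.rpow_mul hb.le,
    boostExponent_mul_tameExponent hε, Real.rpow_one, riemannInvariant, nullState,
    Real.rpow_sub_one hu.1.ne', ← mul_assoc, div_mul_cancel₀ _ hu.1.ne']

lemma riemannInvariant_nullState_le_iff (hε : 0 < ε) (hM : 0 ≤ M) (hu : u ∈ interiorStates ε) :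
    riemannInvariant ε (nullState ε u) ≤ M ^ tameExponent ε ↔
      u.1 * boost ε u.2 ^ boostExponent ε ≤ M := by
  have hb := boost_pos hε hu.2
  have hρ := hu.1
  rw [riemannInvariant_nullState hε hu,
    Real.rpow_le_rpow_iff (by positivity) hM (tameExponent_pos hε)]

lemma mem_invariantRegion_iff (hε : 0 < ε) (hM : 0 ≤ M) (hu : u ∈ phaseSpace ε) :
    u ∈ invariantRegion ε M ↔
      (0 < u.1 → riemannInvariant ε (nullState ε u) ≤ M ^ tameExponent ε ∧
        riemannInvariant ε (reflect (nullState ε u)) ≤ M ^ tameExponent ε) := by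
  refine (and_iff_right hu).trans (forall_congr' fun hρ => ?_)
  have hv := hu.2.2 hρ
  have hneg : (u.1, -u.2) ∈ interiorStates ε := ⟨hρ, (abs_neg u.2).symm ▸ hv⟩
  rw [mul_boost_abs_rpow_le_iff hε hρ.le hv, reflect_nullState,
    riemannInvariant_nullState_le_iff hε hM ⟨hρ, hv⟩, riemannInvariant_nullState_le_iff hε hM hneg]

end RiemannInvariants

section RiemannProblem

variable {ε : ℝ} {ul ur : ℝ × ℝ} {r : ℝ → ℝ × ℝ} {l : Filter ℝ}

lemma tendsto_nullState {a : ℝ × ℝ} (hε : 0 < ε) (hε1 : ε < 1) (hr : ∀ ξ, r ξ ∈ phaseSpace ε)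
    (ha : a ∈ phaseSpace ε) (h : Tendsto (fun ξ => cons ε (r ξ)) l (𝓝 (cons ε a))) :
    Tendsto (fun ξ => nullState ε (r ξ)) l (𝓝 (nullState ε a)) := by
  have hnull := ((continuous_nullOf ε).tendsto (cons ε a)).comp h
  rw [nullOf_cons hε hε1 ha] at hnull
  exact hnull.congr fun ξ => nullOf_cons hε hε1 (hr ξ)

lemma isEntropyJump_refl (ε s : ℝ) (a : ℝ × ℝ) : IsEntropyJump ε s a a := by
  simp only [IsEntropyJump, sub_self, mul_zero, le_refl, implies_true, and_self]

lemma hasDerivAt_nullState {ξ g : ℝ} (hε : 0 < ε) (hε1 : ε < 1) (hr : ∀ η, r η ∈ phaseSpace ε)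
    (hG : HasDerivAt (fun η => G ε (r η)) g ξ) (hH : HasDerivAt (fun η => H ε (r η)) (ξ * g) ξ)
    (hF : HasDerivAt (fun η => F ε (r η)) (ξ * (ξ * g)) ξ) :
    HasDerivAt (fun η => (nullState ε (r η)).1)
        ((1 + ε * ξ) * (1 - ε * ξ) * (g / (1 - ε ^ 2))) ξ ∧
      HasDerivAt (fun η => (nullState ε (r η)).2.1)
        (nullCoeff ε * (1 + ε * ξ) ^ 2 * (g / (1 - ε ^ 2))) ξ ∧
      HasDerivAt (fun η => (nullState ε (r η)).2.2)
        (nullCoeff ε * (1 - ε * ξ) ^ 2 * (g / (1 - ε ^ 2))) ξ := by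
  have hsub : 1 - ε ^ 2 ≠ 0 := (sub_pos.2 (pow_lt_one₀ hε.le hε1 two_ne_zero)).ne'
  have hadd : 1 + ε ^ 2 ≠ 0 := by positivity
  have hdensity : (fun η => (nullState ε (r η)).1) =
      fun η => (G ε (r η) - ε ^ 2 * F ε (r η)) / (1 - ε ^ 2) := funext fun η => by
    rw [← density_eq hε (hr η), mul_div_cancel_left₀ _ hsub, nullState]
  have hplus : (fun η => (nullState ε (r η)).2.1) =
      fun η => (G ε (r η) + 2 * ε * H ε (r η) + ε ^ 2 * F ε (r η)) / (1 + ε ^ 2) :=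
    funext fun η => by
      rw [← density_mul_boost_eq hε (hr η), mul_div_cancel_left₀ _ hadd, nullState]
  have hminus : (fun η => (nullState ε (r η)).2.2) =
      fun η => (G ε (r η) - 2 * ε * H ε (r η) + ε ^ 2 * F ε (r η)) / (1 + ε ^ 2) :=
    funext fun η => by
      rw [← density_div_boost_eq hε (hr η), mul_div_cancel_left₀ _ hadd, nullState]
  rw [hdensity, hplus, hminus, nullCoeff]
  refine ⟨((hG.sub (hF.const_mul (ε ^ 2))).div_const _).congr_deriv ?_,
    (((hG.add (hH.const_mul (2 * ε))).add (hF.const_mul (ε ^ 2))).div_const _).congr_deriv ?_,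
    (((hG.sub (hH.const_mul (2 * ε))).add (hF.const_mul (ε ^ 2))).div_const _).congr_deriv ?_⟩ <;>
  · field_simp
    ring

namespace IsRiemannSolution

lemma exists_isNullProfile (h : IsRiemannSolution ε ul ur r) (hε : 0 < ε) (hε1 : ε < 1) :
    ∃ γ S, IsNullProfile ε (fun ξ => nullState ε (r ξ)) γ S := by
  obtain ⟨S, hsmooth, hjumps⟩ := h.piecewise
  have hr := h.mem_phaseSpace
  have hderiv := fun ξ (hξ : ξ ∉ S) =>
    have ⟨hcons, hH, hF⟩ := hsmooth ξ hξ
    hasDerivAt_nullState hε hε1 hr (hcons.fst.differentiableAt one_ne_zero).hasDerivAt hH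
      (hH.deriv ▸ hF)
  refine ⟨fun ξ => deriv (fun η => G ε (r η)) ξ / (1 - ε ^ 2), S,
    fun ξ => isNullTriple_nullState hε (hr ξ), fun ξ hξ => ?_, fun ξ hξ => (hderiv ξ hξ).1,
    fun ξ hξ => (hderiv ξ hξ).2.1, fun ξ hξ => (hderiv ξ hξ).2.2, fun s => ?_⟩
  · have hG : ContDiffAt ℝ 1 (fun η => G ε (r η)) ξ := (hsmooth ξ hξ).1.fst
    exact ((hG.fderiv_right (m := 0) (by norm_num)).continuousAt.clm_apply
      continuousAt_const).div_const _
  by_cases hs : s ∈ S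
  · obtain ⟨a, ha, b, hb, hleft, hright, hvalue, hjump⟩ := hjumps s hs
    exact ⟨nullState ε a, nullState ε b, tendsto_nullState hε hε1 hr ha hleft,
      tendsto_nullState hε hε1 hr hb hright,
      hvalue.imp (congrArg (nullState ε)) (congrArg (nullState ε)), hjump.isNullJump hε hε1 ha hb⟩
  · have hcont := tendsto_nullState hε hε1 hr (hr s) (hsmooth s hs).1.continuousAt
    exact ⟨nullState ε (r s), nullState ε (r s), hcont.mono_left nhdsWithin_le_nhds,
      hcont.mono_left nhdsWithin_le_nhds, Or.inl rfl,
      (isEntropyJump_refl ε s (r s)).isNullJump hε hε1 (hr s) (hr s)⟩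

theorem mem_invariantRegion {M : ℝ} (h : IsRiemannSolution ε ul ur r) (hε : 0 < ε) (hε1 : ε < 1)
    (hM : 0 ≤ M) (hl : ul ∈ invariantRegion ε M) (hr : ur ∈ invariantRegion ε M) (ξ : ℝ) :
    r ξ ∈ invariantRegion ε M := by
  obtain ⟨γ, S, hprofile⟩ := h.exists_isNullProfile hε hε1
  have hleft := tendsto_nullState hε hε1 h.mem_phaseSpace hl.1 h.left_data
  have hright := tendsto_nullState hε hε1 h.mem_phaseSpace hr.1 h.right_data
  have hl_le := (mem_invariantRegion_iff hε hM hl.1).1 hl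
  have hr_le := (mem_invariantRegion_iff hε hM hr.1).1 hr
  refine (mem_invariantRegion_iff hε hM (h.mem_phaseSpace ξ)).2 fun hpos => ⟨?_, ?_⟩
  · rcases hprofile.riemannInvariant_le_data hε hε1 hleft hright hpos with ⟨hρ, hle⟩ | ⟨hρ, hle⟩
    exacts [hle.trans (hl_le hρ).1, hle.trans (hr_le hρ).1]
  · have hle_data := hprofile.reflect.riemannInvariant_le_data (ξ := -ξ) hε hε1
      (((continuous_reflect.tendsto _).comp hright).comp tendsto_neg_atBot_atTop)
      (((continuous_reflect.tendsto _).comp hleft).comp tendsto_neg_atTop_atBot)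
      ((neg_neg ξ).symm ▸ hpos)
    rw [neg_neg] at hle_data
    rcases hle_data with ⟨hρ, hle⟩ | ⟨hρ, hle⟩
    exacts [hle.trans (hr_le hρ).2, hle.trans (hl_le hρ).2]

end IsRiemannSolution

end RiemannProblem

/-! ### Stability of the invariant region under averaging -/

/-- The value at the boost factor `y` of the linear form in the conservative variables that
supports the region `ρ * b ^ k ≤ 1` at the boost factor `b = z`, where `k = boostExponent ε` and
`d = nullCoeff ε`. It is evaluated on the boundary `ρ = y ^ (-k)`, and the coefficients are those
for which it is stationary at `y = z`. -/
def supportProfile (k d z y : ℝ) : ℝ :=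
  ((1 + k + k * d * z) * (y + d) - ((k - 1) * z ^ 2 + k * d * z) * (y⁻¹ + d)) * y ^ (-k)

/-- The linear form of `supportProfile`, up to a positive factor, as a functional of the
conservative variables `(G, H)`. -/
def supportFunctional (ε z : ℝ) : ℝ × ℝ →L[ℝ] ℝ :=
  (1 + boostExponent ε + boostExponent ε * nullCoeff ε * z) •
      (ContinuousLinearMap.fst ℝ ℝ ℝ + ε • ContinuousLinearMap.snd ℝ ℝ ℝ) -
    ((boostExponent ε - 1) * z ^ 2 + boostExponent ε * nullCoeff ε * z) •
      (ContinuousLinearMap.fst ℝ ℝ ℝ - ε • ContinuousLinearMap.snd ℝ ℝ ℝ)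

section SupportProfile

variable {k d z y : ℝ}

lemma supportProfile_self_pos (hd : 0 < d) (hz : 0 < z) : 0 < supportProfile k d z z := by
  have hself : supportProfile k d z z = (2 * z + d * z ^ 2 + d) * z ^ (-k) := by
    simp only [supportProfile]; field_simp; ring
  rw [hself]; positivity

lemma hasDerivAt_supportProfile (k d z : ℝ) (hy : 0 < y) :
    HasDerivAt (supportProfile k d z) (-(y ^ (-k) / y ^ 2 * ((k ^ 2 - 1) * (y + z)
      + k * d * (k + 1) + k * d * (k - 1) * y * z)) * (y - z)) y := by
  have hlinear : HasDerivAt (fun y : ℝ => (1 + k + k * d * z) * (y + d) -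
      ((k - 1) * z ^ 2 + k * d * z) * (y⁻¹ + d)) ((1 + k + k * d * z) * 1 -
      ((k - 1) * z ^ 2 + k * d * z) * (-(y ^ 2)⁻¹)) y :=
    (((hasDerivAt_id y).add_const d).const_mul _).sub
      (((hasDerivAt_inv hy.ne').add_const d).const_mul _)
  refine (hlinear.mul (Real.hasDerivAt_rpow_const (p := -k) (Or.inl hy.ne'))).congr_deriv ?_
  rw [Real.rpow_sub_one hy.ne']
  field_simp
  ring

lemma supportProfile_le_self (hk : 1 < k) (hd : 0 < d) (hz : 0 < z) (hy : 0 < y) :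
    supportProfile k d z y ≤ supportProfile k d z z := by
  refine le_of_forall_hasDerivAt_mul_sub_nonpos Set.ordConnected_Ioi
    (fun x hx => hasDerivAt_supportProfile k d z hx) hy hz fun x hx => ?_
  have hx : 0 < x := hx
  have hk2 : 0 < k ^ 2 - 1 := sub_pos.2 (one_lt_pow₀ hk two_ne_zero)
  rw [mul_assoc, ← sq, neg_mul, Left.neg_nonpos_iff]
  positivity

end SupportProfile

section SupportFunctional

variable {ε z M : ℝ} {u : ℝ × ℝ}

lemma supportFunctional_cons (hε : 0 < ε) (hu : u ∈ interiorStates ε) (z : ℝ) :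
    supportFunctional ε z (cons ε u) = (1 + ε ^ 2) / 2 *
      ((u.1 * boost ε u.2 ^ boostExponent ε) *
        supportProfile (boostExponent ε) (nullCoeff ε) z (boost ε u.2)) := by
  have hphase := interiorStates_subset_phaseSpace hu
  have hb := boost_pos hε hu.2
  have hd : nullCoeff ε * (1 + ε ^ 2) = 1 - ε ^ 2 := div_mul_cancel₀ _ (by positivity)
  have hplus : G ε u + ε * H ε u = (1 + ε ^ 2) / 2 * (u.1 * (boost ε u.2 + nullCoeff ε)) := by
    rw [G_eq hε hphase, mul_H_eq hε hphase]
    linear_combination (-u.1 / 2) * hd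
  have hminus : G ε u - ε * H ε u =
      (1 + ε ^ 2) / 2 * (u.1 * ((boost ε u.2)⁻¹ + nullCoeff ε)) := by
    rw [G_eq hε hphase, mul_H_eq hε hphase, div_eq_mul_inv u.1]
    linear_combination (-u.1 / 2) * hd
  have hrpow : boost ε u.2 ^ boostExponent ε * boost ε u.2 ^ (-boostExponent ε) = 1 := by
    rw [← Real.rpow_add hb, add_neg_cancel, Real.rpow_zero]
  calc supportFunctional ε z (cons ε u)
      = (1 + boostExponent ε + boostExponent ε * nullCoeff ε * z) * (G ε u + ε * H ε u) -
        ((boostExponent ε - 1) * z ^ 2 + boostExponent ε * nullCoeff ε * z) *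
          (G ε u - ε * H ε u) := rfl
    _ = _ := by
      rw [hplus, hminus, supportProfile]
      linear_combination (-((1 + ε ^ 2) / 2 * u.1 *
        ((1 + boostExponent ε + boostExponent ε * nullCoeff ε * z) * (boost ε u.2 + nullCoeff ε) -
          ((boostExponent ε - 1) * z ^ 2 + boostExponent ε * nullCoeff ε * z) *
            ((boost ε u.2)⁻¹ + nullCoeff ε)))) * hrpow

lemma supportFunctional_cons_le (hε : 0 < ε) (hε1 : ε < 1) (hM : 0 ≤ M) (hz : 0 < z)
    (hu : u ∈ phaseSpace ε) (hle : 0 < u.1 → u.1 * boost ε u.2 ^ boostExponent ε ≤ M) :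
    supportFunctional ε z (cons ε u) ≤
      (1 + ε ^ 2) / 2 * (M * supportProfile (boostExponent ε) (nullCoeff ε) z z) := by
  have hd := nullCoeff_pos hε hε1
  have hself := supportProfile_self_pos (k := boostExponent ε) hd hz
  rcases mem_interiorStates_or_eq_zero hu with hint | hvacuum
  · have hb := boost_pos hε hint.2
    have hρ := hint.1
    rw [supportFunctional_cons hε hint]
    gcongr ?_ * ?_
    calc u.1 * boost ε u.2 ^ boostExponent ε *
          supportProfile (boostExponent ε) (nullCoeff ε) z (boost ε u.2)
        ≤ u.1 * boost ε u.2 ^ boostExponent ε *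
          supportProfile (boostExponent ε) (nullCoeff ε) z z := by
          gcongr
          exact supportProfile_le_self (one_lt_boostExponent hε hε1) hd hz hb
      _ ≤ M * supportProfile (boostExponent ε) (nullCoeff ε) z z := by
          gcongr
          exact hle hρ
  · have hcons : cons ε u = 0 := by simp only [cons, G, H, hvacuum, mul_zero, zero_mul]; rfl
    rw [hcons, map_zero]
    positivity

lemma mul_boost_rpow_le_of_supportFunctional_cons_le (hε : 0 < ε) (hε1 : ε < 1)
    (hu : u ∈ interiorStates ε)
    (hle : supportFunctional ε (boost ε u.2) (cons ε u) ≤ (1 + ε ^ 2) / 2 *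
      (M * supportProfile (boostExponent ε) (nullCoeff ε) (boost ε u.2) (boost ε u.2))) :
    u.1 * boost ε u.2 ^ boostExponent ε ≤ M := by
  rw [supportFunctional_cons hε hu] at hle
  exact le_of_mul_le_mul_right (le_of_mul_le_mul_left hle (by positivity))
    (supportProfile_self_pos (nullCoeff_pos hε hε1) (boost_pos hε hu.2))

end SupportFunctional

lemma G_le_of_mem_invariantRegion {ε M : ℝ} {u : ℝ × ℝ} (hε : 0 < ε) (hε1 : ε < 1) (hM : 0 ≤ M)
    (hu : u ∈ invariantRegion ε M) : G ε u ≤ M := by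
  rcases mem_interiorStates_or_eq_zero hu.1 with ⟨hρ, hv⟩ | hvacuum
  · have habs : (u.1, |u.2|) ∈ phaseSpace ε := by
      simpa only [phaseSpace, Set.mem_ofPred_eq, abs_abs] using hu.1
    have hG : G ε u = G ε (u.1, |u.2|) := by simp only [G, sq_abs]
    have hb := one_le_boost_abs hε hv
    have hplus : u.1 * boost ε |u.2| ≤ M := calc
      u.1 * boost ε |u.2| ≤ u.1 * boost ε |u.2| ^ boostExponent ε := by
        gcongr; exact Real.self_le_rpow_of_one_le hb (one_lt_boostExponent hε hε1).le
      _ ≤ M := hu.2 hρ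
    have hdensity : u.1 ≤ M := (le_mul_of_one_le_right hρ.le hb).trans hplus
    have hminus : u.1 / boost ε |u.2| ≤ M := (div_le_self hρ.le hb).trans hdensity
    have hsub : 0 ≤ 1 - ε ^ 2 := sub_nonneg.2 (pow_le_one₀ hε.le hε1.le)
    rw [hG, G_eq hε habs]
    calc ((1 + ε ^ 2) * (u.1 * boost ε |u.2| + u.1 / boost ε |u.2|) + 2 * (1 - ε ^ 2) * u.1) / 4
        ≤ ((1 + ε ^ 2) * (M + M) + 2 * (1 - ε ^ 2) * M) / 4 := by gcongr
      _ = M := by ring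
  · simpa only [G, hvacuum, mul_zero] using hM

lemma cons_neg_velocity (ε : ℝ) (u : ℝ × ℝ) : cons ε (u.1, -u.2) = (G ε u, -H ε u) := by
  simp only [cons, G, H, neg_sq, mul_neg]

namespace IsCellAverage

open MeasureTheory

variable {ε h x₀ M : ℝ} {u : ℝ → ℝ × ℝ} {c : ℝ × ℝ}

lemma map_cons_le {K : ℝ} (hc : IsCellAverage ε h x₀ u c) (hh : 0 < h)
    (hint : IntervalIntegrable (fun x => cons ε (u x)) volume (x₀ - h) (x₀ + h))
    (L : ℝ × ℝ →L[ℝ] ℝ) (hle : ∀ x, L (cons ε (u x)) ≤ K) : L (cons ε c) ≤ K := by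
  have hcons : cons ε c = (2 * h)⁻¹ • ∫ x in (x₀ - h)..(x₀ + h), cons ε (u x) := by
    have hfst := (ContinuousLinearMap.fst ℝ ℝ ℝ).intervalIntegral_comp_comm hint
    have hsnd := (ContinuousLinearMap.snd ℝ ℝ ℝ).intervalIntegral_comp_comm hint
    exact Prod.ext (hc.2.1.trans (congrArg _ hfst)) (hc.2.2.trans (congrArg _ hsnd))
  calc L (cons ε c) = (2 * h)⁻¹ * ∫ x in (x₀ - h)..(x₀ + h), L (cons ε (u x)) := by
        rw [hcons, map_smul, L.intervalIntegral_comp_comm hint, smul_eq_mul]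
    _ ≤ (2 * h)⁻¹ * ∫ _ in (x₀ - h)..(x₀ + h), K := by
        gcongr
        exact intervalIntegral.integral_mono_on (by linarith)
          ⟨L.integrable_comp hint.1, L.integrable_comp hint.2⟩ intervalIntegrable_const
          fun x _ => hle x
    _ = K := by
        rw [intervalIntegral.integral_const, smul_eq_mul]
        field_simp
        ring

lemma neg_velocity (hc : IsCellAverage ε h x₀ u c) :
    IsCellAverage ε h x₀ (fun x => ((u x).1, -(u x).2)) (c.1, -c.2) := by
  obtain ⟨hphase, hG, hH⟩ := hc
  have hG_neg (w : ℝ × ℝ) : G ε (w.1, -w.2) = G ε w := congrArg Prod.fst (cons_neg_velocity ε w)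
  have hH_neg (w : ℝ × ℝ) : H ε (w.1, -w.2) = -H ε w := congrArg Prod.snd (cons_neg_velocity ε w)
  refine ⟨by simpa only [phaseSpace, Set.mem_ofPred_eq, abs_neg] using hphase,
    by simpa only [hG_neg] using hG, ?_⟩
  simp only [hH_neg, intervalIntegral.integral_neg, mul_neg, hH]

lemma mul_boost_rpow_le (hc : IsCellAverage ε h x₀ u c) (hε : 0 < ε) (hε1 : ε < 1) (hM : 0 ≤ M)
    (hh : 0 < h) (hm : Measurable fun x => cons ε (u x)) (hu : ∀ x, u x ∈ invariantRegion ε M)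
    (hpos : 0 < c.1) : c.1 * boost ε c.2 ^ boostExponent ε ≤ M := by
  have hG : ∀ x, G ε (u x) ≤ M := fun x => G_le_of_mem_invariantRegion hε hε1 hM (hu x)
  have hbound : ∀ x, ‖cons ε (u x)‖ ≤ max M (M / ε) := fun x => by
    refine max_le_max ?_ ?_
    · exact (Real.norm_of_nonneg (G_nonneg hε (hu x).1)).trans_le (hG x)
    · exact (le_div_iff₀' hε).2 ((mul_abs_H_le_G hε hε1 (hu x).1).trans (hG x))
  have hint : IntervalIntegrable (fun x => cons ε (u x)) volume (x₀ - h) (x₀ + h) :=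
    intervalIntegrable_const.mono_fun' hm.aestronglyMeasurable (Eventually.of_forall hbound)
  have hinterior : c ∈ interiorStates ε := ⟨hpos, hc.1.2.2 hpos⟩
  exact mul_boost_rpow_le_of_supportFunctional_cons_le hε hε1 hinterior <|
    hc.map_cons_le hh hint _ fun x =>
      supportFunctional_cons_le hε hε1 hM (boost_pos hε hinterior.2) (hu x).1 fun hρ =>
        ((mul_boost_abs_rpow_le_iff hε hρ.le ((hu x).1.2.2 hρ)).1 ((hu x).2 hρ)).1

theorem mem_invariantRegion (hc : IsCellAverage ε h x₀ u c) (hε : 0 < ε) (hε1 : ε < 1)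
    (hM : 0 ≤ M) (hh : 0 < h) (hm : Measurable fun x => cons ε (u x))
    (hu : ∀ x, u x ∈ invariantRegion ε M) : c ∈ invariantRegion ε M := by
  refine ⟨hc.1, fun hpos => (mul_boost_abs_rpow_le_iff hε hpos.le (hc.1.2.2 hpos)).2
    ⟨hc.mul_boost_rpow_le hε hε1 hM hh hm hu hpos,
      hc.neg_velocity.mul_boost_rpow_le hε hε1 hM hh ?_ (fun x => ?_) hpos⟩⟩
  · simp only [cons_neg_velocity]
    exact hm.fst.prodMk hm.snd.neg
  · simpa only [invariantRegion, phaseSpace, Set.mem_ofPred_eq, abs_neg] using hu x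

end IsCellAverage

/-! ### Uniformity in the light speed -/

section LightSpeed

variable {ε ε₀ M : ℝ} {u : ℝ × ℝ}

lemma hasSum_log_boost {v : ℝ} (hε : 0 < ε) (hv : ε * |v| < 1) :
    HasSum (fun n : ℕ => (1 + ε ^ 2) * (1 / (2 * n + 1)) * (ε ^ (2 * n) * v ^ (2 * n + 1)))
      (boostExponent ε * Real.log (boost ε v)) := by
  have hsum := (Real.hasSum_log_sub_log_of_abs_lt_one (x := ε * v)
    (by rwa [abs_mul, abs_of_pos hε])).mul_left (boostExponent ε)
  rw [← Real.log_div (one_add_mul_pos hε hv).ne' (one_sub_mul_pos hε hv).ne'] at hsum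
  refine hsum.congr_fun fun n => ?_
  rw [boostExponent, mul_pow, pow_succ ε]
  field_simp
  ring

lemma boost_rpow_boostExponent_le {v : ℝ} (hε : 0 < ε) (hle : ε ≤ ε₀) (hv0 : 0 ≤ v)
    (hv : ε₀ * v < 1) : boost ε v ^ boostExponent ε ≤ boost ε₀ v ^ boostExponent ε₀ := by
  have hε₀ := hε.trans_le hle
  have habs₀ : ε₀ * |v| < 1 := by rwa [abs_of_nonneg hv0]
  have habs : ε * |v| < 1 := (mul_le_mul_of_nonneg_right hle (abs_nonneg v)).trans_lt habs₀
  rw [Real.rpow_def_of_pos (boost_pos hε habs), Real.rpow_def_of_pos (boost_pos hε₀ habs₀),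
    Real.exp_le_exp, mul_comm, mul_comm (Real.log _)]
  exact hasSum_le (fun n => by gcongr) (hasSum_log_boost hε habs) (hasSum_log_boost hε₀ habs₀)

lemma mul_boost_abs_rpow_le_of_mem_tameRegion (hε : 0 < ε) (hM : 0 < M) (hu : u ∈ tameRegion ε M)
    (hρ : 0 < u.1) : u.1 * boost ε |u.2| ^ boostExponent ε ≤ 2 ^ boostExponent ε * M := by
  have hratio : 0 < u.1 / M := div_pos hρ hM
  have htame := Real.rpow_pos_of_pos hratio (tameExponent ε)
  have hgap : 0 < 1 - ε * |u.2| := htame.trans_le hu.2.2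
  have hboost : boost ε |u.2| ≤ 2 / (u.1 / M) ^ tameExponent ε :=
    div_le_div₀ zero_le_two (by linarith) htame hu.2.2
  calc u.1 * boost ε |u.2| ^ boostExponent ε
      ≤ u.1 * (2 / (u.1 / M) ^ tameExponent ε) ^ boostExponent ε := by
        have := one_le_boost_abs hε (sub_pos.1 hgap)
        have := boostExponent_pos hε
        gcongr
    _ = u.1 * (2 ^ boostExponent ε / (u.1 / M)) := by
        rw [Real.div_rpow zero_le_two htame.le, ← Real.rpow_mul hratio.le,
          mul_comm (tameExponent ε), boostExponent_mul_tameExponent hε, Real.rpow_one]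
    _ = 2 ^ boostExponent ε * M := by field_simp

lemma mem_invariantRegion_of_mem_tameRegion (hε : 0 < ε) (hle : ε ≤ ε₀) (hM : 0 < M)
    (hu : u ∈ tameRegion ε₀ M) : u ∈ invariantRegion ε (2 ^ boostExponent ε₀ * M) := by
  have hε₀ := hε.trans_le hle
  have hphase := tameRegion_subset_phaseSpace hM hu
  have hspeed : ε * |u.2| ≤ ε₀ * |u.2| := mul_le_mul_of_nonneg_right hle (abs_nonneg _)
  refine ⟨⟨hphase.1, hspeed.trans hphase.2.1, fun hρ => hspeed.trans_lt (hphase.2.2 hρ)⟩,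
    fun hρ => ?_⟩
  calc u.1 * boost ε |u.2| ^ boostExponent ε
      ≤ u.1 * boost ε₀ |u.2| ^ boostExponent ε₀ :=
        mul_le_mul_of_nonneg_left
          (boost_rpow_boostExponent_le hε hle (abs_nonneg _) (hphase.2.2 hρ)) hρ.le
    _ ≤ _ := mul_boost_abs_rpow_le_of_mem_tameRegion hε₀ hM hu hρ

lemma mem_tameRegion_of_mem_invariantRegion (hε : 0 < ε) (hM : 0 < M)
    (hu : u ∈ invariantRegion ε M) : u ∈ tameRegion ε M := by
  have htame := tameExponent_pos hε
  rcases mem_interiorStates_or_eq_zero hu.1 with ⟨hρ, hv⟩ | hvacuum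
  · have hb := one_le_boost_abs hε hv
    have hnonneg : 0 ≤ ε * |u.2| := by positivity
    have hpow : 1 ≤ boost ε |u.2| ^ boostExponent ε :=
      Real.one_le_rpow hb (boostExponent_pos hε).le
    refine ⟨hρ.le, (le_mul_of_one_le_right hρ.le hpow).trans (hu.2 hρ), ?_⟩
    calc (u.1 / M) ^ tameExponent ε
        ≤ ((boost ε |u.2| ^ boostExponent ε)⁻¹) ^ tameExponent ε := by
          gcongr
          rw [div_le_iff₀ hM, inv_mul_eq_div, le_div_iff₀ (by positivity)]
          exact hu.2 hρ
      _ = (boost ε |u.2|)⁻¹ := by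
          rw [Real.inv_rpow (by positivity), ← Real.rpow_mul (by positivity),
            boostExponent_mul_tameExponent hε, Real.rpow_one]
      _ ≤ 1 - ε * |u.2| := by
          rw [boost, inv_div]
          exact div_le_self (by linarith) (by linarith)
  · refine ⟨hu.1.1, hvacuum ▸ hM.le, ?_⟩
    rw [hvacuum, zero_div, Real.zero_rpow htame.ne']
    exact sub_nonneg.2 hu.1.2.1

end LightSpeed

/-! ### Lax-Friedrichs approximations -/

lemma measurable_cons (ε : ℝ) : Measurable (cons ε) := by unfold cons G H; fun_prop

lemma IsRiemannSolution.measurable_cons {ε : ℝ} {ul ur : ℝ × ℝ} {r : ℝ → ℝ × ℝ}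
    (h : IsRiemannSolution ε ul ur r) : Measurable fun ξ => cons ε (r ξ) := by
  obtain ⟨S, hsmooth, -⟩ := h.piecewise
  exact measurable_of_continuousAt_of_notMem_countable S.countable_toSet
    fun ξ hξ => (hsmooth ξ hξ).1.continuousAt

lemma exists_even_add_and_mem_Ico (n : ℤ) (y : ℝ) :
    ∃ j : ℤ, Even (n + j) ∧ y ∈ Set.Ico (j : ℝ) (j + 2) := by
  have hfloor := Int.floor_le y
  have hlt := Int.lt_floor_add_one y
  rcases Int.even_or_odd (n + ⌊y⌋) with heven | hodd
  · exact ⟨⌊y⌋, heven, hfloor, by linarith⟩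
  · refine ⟨⌊y⌋ - 1, ?_, ?_, ?_⟩
    · rw [← add_sub_assoc]; exact hodd.sub_odd odd_one
    all_goals push_cast; linarith

lemma exists_nat_mul_le_and_lt_mul {τ t : ℝ} (hτ : 0 < τ) (ht : 0 ≤ t) :
    ∃ n : ℕ, n * τ ≤ t ∧ t < (n + 1) * τ :=
  ⟨⌊t / τ⌋₊, (le_div_iff₀ hτ).1 (Nat.floor_le (by positivity)),
    (div_lt_iff₀ hτ).1 (Nat.lt_floor_add_one _)⟩

section LaxFriedrichs

variable {ε τ h M : ℝ} {u₀ : ℝ → ℝ × ℝ} {uh : ℝ → ℝ → ℝ × ℝ}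

lemma cell_mem_invariantRegion {cell : ℕ → ℤ → ℝ × ℝ} (hε : 0 < ε) (hε1 : ε < 1) (hM : 0 ≤ M)
    (hh : 0 < h) (hm : Measurable u₀) (hu₀ : ∀ x, u₀ x ∈ invariantRegion ε M)
    (hinit : ∀ j : ℤ, Even j → IsCellAverage ε h (j * h) u₀ (cell 0 j))
    (hstep : ∀ (n : ℕ) (j : ℤ), Even ((n : ℤ) + j) →
      ∃ r, IsRiemannSolution ε (cell n j) (cell n (j + 2)) r ∧
        IsCellAverage ε h ((j + 1) * h) (fun x => r ((x - (j + 1) * h) / τ))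
          (cell (n + 1) (j + 1)))
    (n : ℕ) : ∀ j : ℤ, Even ((n : ℤ) + j) → cell n j ∈ invariantRegion ε M := by
  induction n with
  | zero =>
    intro j hj
    exact (hinit j (by simpa using hj)).mem_invariantRegion hε hε1 hM hh
      ((measurable_cons ε).comp hm) hu₀
  | succ n ih =>
    intro j hj
    obtain ⟨i, rfl⟩ : ∃ i : ℤ, j = i + 1 := ⟨j - 1, (sub_add_cancel j 1).symm⟩
    have hi : Even ((n : ℤ) + i) := by push_cast at hj; grind
    obtain ⟨r, hr, havg⟩ := hstep n i hi
    refine havg.mem_invariantRegion hε hε1 hM hh (hr.measurable_cons.comp (by fun_prop)) fun x => ?_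
    exact hr.mem_invariantRegion hε hε1 hM (ih i hi) (ih (i + 2) (by grind)) _

theorem IsLaxFriedrichs.mem_invariantRegion (hLF : IsLaxFriedrichs ε τ h u₀ uh) (hε : 0 < ε)
    (hε1 : ε < 1) (hM : 0 ≤ M) (hτ : 0 < τ) (hh : 0 < h) (hm : Measurable u₀)
    (hu₀ : ∀ x, u₀ x ∈ invariantRegion ε M) {t : ℝ} (ht : 0 ≤ t) (x : ℝ) :
    uh t x ∈ invariantRegion ε M := by
  obtain ⟨cell, hinit, hcell, hstep⟩ := hLF
  have hcells := cell_mem_invariantRegion hε hε1 hM hh hm hu₀ hinit fun n j hj =>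
    (hstep n j hj).imp fun r hr => ⟨hr.1, hr.2.2⟩
  obtain ⟨n, hle, hlt⟩ := exists_nat_mul_le_and_lt_mul hτ ht
  rcases hle.eq_or_lt with rfl | hgt
  · obtain ⟨j, hj, hjx, hxj⟩ := exists_even_add_and_mem_Ico (n + 1) (x / h)
    rw [le_div_iff₀ hh] at hjx
    rw [div_lt_iff₀ hh] at hxj
    have hj' : Even ((n : ℤ) + (j + 1)) := by grind
    rw [hcell n (j + 1) hj' x ⟨by push_cast; linarith, by push_cast; linarith⟩]
    exact hcells n _ hj'
  · obtain ⟨j, hj, hjx, hxj⟩ := exists_even_add_and_mem_Ico n (x / h)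
    obtain ⟨r, hr, hvalue, -⟩ := hstep n j hj
    rw [hvalue t ⟨hgt, hlt⟩ x ⟨(le_div_iff₀ hh).1 hjx, (div_lt_iff₀ hh).1 hxj⟩]
    exact hr.mem_invariantRegion hε hε1 hM (hcells n j hj) (hcells n _ (by grind)) _

end LaxFriedrichs

end RelEuler

end

theorem lemma5p2_general {ε₀ : ℝ} (hε₀1 : ε₀ < 1) {u₀ : ℝ → ℝ × ℝ}
    (hdata : RelEuler.IsTameData ε₀ u₀) :
    ∃ M : ℝ, 0 < M ∧ ∀ ε : ℝ, 0 < ε → ε ≤ ε₀ → ∀ τ h : ℝ, 0 < τ → 0 < h →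
      ∀ uh : ℝ → ℝ → ℝ × ℝ, RelEuler.IsLaxFriedrichs ε τ h u₀ uh →
        ∀ t x : ℝ, 0 ≤ t → uh t x ∈ RelEuler.tameRegion ε M := by
  obtain ⟨hm, M₀, hM₀, htame⟩ := hdata
  have hM : 0 < 2 ^ RelEuler.boostExponent ε₀ * M₀ := by positivity
  refine ⟨_, hM, fun ε hε hle τ h hτ hh uh hLF t x ht => ?_⟩
  have hinit : ∀ y, u₀ y ∈ RelEuler.invariantRegion ε (2 ^ RelEuler.boostExponent ε₀ * M₀) :=
    fun y => RelEuler.mem_invariantRegion_of_mem_tameRegion hε hle hM₀ (htame y)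
  exact RelEuler.mem_tameRegion_of_mem_invariantRegion hε hM
    (hLF.mem_invariantRegion hε (hle.trans_lt hε₀1) hM.le hτ hh hm hinit ht x)

theorem lemma5p2 (ε₀ : ℝ) (hε₀ : 0 < ε₀) (hε₀' : ε₀ < 1)
    (ρ₀ v₀ : ℝ → ℝ) (hdata : RelEuler.IsTameData ε₀ (fun x => (ρ₀ x, v₀ x))) :
    ∃ M : ℝ, 0 < M ∧
      ∀ ε : ℝ, 0 < ε → ε ≤ ε₀ →
      ∀ τ h : ℝ, 0 < τ → 0 < h →
      ∀ ρh vh : ℝ → ℝ → ℝ,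
        RelEuler.IsLaxFriedrichs ε τ h (fun x => (ρ₀ x, v₀ x)) (fun t x => (ρh t x, vh t x)) →
        RelEuler.CFL ε τ h (fun t x => (ρh t x, vh t x)) →
        ∀ t x : ℝ, 0 ≤ t →
          0 ≤ ρh t x ∧ ρh t x ≤ M ∧
          1 - ε * |vh t x| ≥ (ρh t x / M) ^ (2 * ε / (1 + ε ^ 2)) :=
  have ⟨M, hM, hbound⟩ := lemma5p2_general hε₀' hdata
  ⟨M, hM, fun ε hε hle τ h hτ hh _ _ hLF _ => hbound ε hε hle τ h hτ hh _ hLF⟩
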